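/- **Setting.** Let $\Omega$ be a finite set of faces of the square lattice (for example all the faces of a rectangle $\mathbf I\times\mathbf J$, or of any square grid domain), let $\beta\in\mathbb R$, and put $\alpha=e^{-2\beta}$. Identify each face with its centre. Let $\mathcal E^*$ be the set of dual edges $\langle p,p'\rangle$ joining two adjacent faces $p,p'\in\Omega$, and let $\mathcal Z=\sum_{\omega}\alpha^{|\omega|}$, where the sum is over all $\omega\subset\mathcal E^*$ such that every face of $\Omega$ belongs to an even number of edges of $\omega$. Let $z_1,\dots,z_{2m}$ be midpoints of pairwise distinct edges of $\Omega$ (sides of faces of $\Omega$, boundary edges included). For each $j$ let $e_j^*$ be the dual edge (of the whole dual lattice) crossing $z_j$, let $o_j\in\{\pm1\}$ (if $e_j^*$ is horizontal) or $o_j\in\{\pm i\}$ (if $e_j^*$ is vertical) be an orientation of $e_j^*$, and let $\varepsilon_j\in\mathbb C$ with $\varepsilon_j^2=o_j$. Define $$f^{\varepsilon}(z_1,\dots,z_{2m})=\frac1{\mathcal Z}\sum_{\gamma\in\mathcal C^{\varepsilon}_{z_1,\dots,z_{2m}}}\alpha^{L(\gamma)}\,\mathrm{sign}(\gamma)\prod_{\pi:z_s\leadsto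 z_d}\frac{\varepsilon_d}{\varepsilon_s}\,e^{-\frac i2 W(\pi)},$$ where: * $\mathcal C^{\varepsilon}_{z_1,\dots,z_{2m}}$ is the set of all $\gamma$ that consist of the $2m$ half-edges $\langle z_j,z_j+\frac{o_j}2\rangle$ and of a set of dual edges in $\mathcal E^*\setminus\{e_1^*,\dots,e_{2m}^*\}$, such that every face of $\Omega$ belongs to an even number of edges and half-edges of $\gamma$. If some $z_j+\frac{o_j}2$ is not a face of $\Omega$, this set is empty (and $f^\varepsilon=0$). $L(\gamma)$ is the number of full dual edges of $\gamma$ plus $m$. * $\gamma$ decomposes into loops and $m$ paths linking the $z_j$ in pairs, once at every face that belongs to four edges or half-edges of $\gamma$ these are linked in two pairs in such a way that each passage turns left or right (going straight is forbidden). The product is over the $m$ paths $\pi$, each oriented from $z_s$ to $z_d$ with $s<d$, and $W(\pi)$ is the total (counterclockwise) turning angle of $\pi$. * $\mathrm{sign}(\gamma)=(-1)^{c}$, where $c$ is the number of crossings of the pair partition of $\{1,\dots,2m\}$ induced by the paths, i.e. the number of pairs of paths $z_s\leadsto z_d$, $z_{s'}\leadsto z_{d'}$ with $s<s'<d<d'$.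 **Statement (Pfaffian formula for multipoint parafermionic observables).** Let $n\ge 0$, let $z_1,\dots,z_{2n}$ be midpoints of pairwise distinct edges of $\Omega$, with orientations $o_1,\dots,o_{2n}$ of the corresponding dual edges, and let $\varepsilon_j^2=o_j$ for all $j$. Then the matrix $A=\big(f^{(\varepsilon_j,\varepsilon_k)}(z_j,z_k)\,\mathbf 1_{j\ne k}\big)_{1\le j,k\le 2n}$ is antisymmetric, and $$f^{\varepsilon}(z_1,\dots,z_{2n})=\mathrm{Pf}(A)=\frac1{2^n n!}\sum_{\sigma\in S_{2n}}\mathrm{sgn}(\sigma)\prod_{s=1}^n A_{\sigma(2s-1),\sigma(2s)} .$$ This holds for every way of resolving the ambiguities of the paths, which may be chosen separately for each configuration $\gamma$, on the left-hand side and in each entry of $A$. -/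

import Mathlib

namespace Parafermion

/-- Faces of the square lattice, i.e. vertices of the dual lattice. The face `(x, y)` is identified
with its centre, and faces are translated so that the centres are the points of `ℤ²`; the edges of
the (primal) square lattice then cross the dual edges at the midpoints of the latter. -/
abbrev Face := ℤ × ℤ

/-- The four lattice directions: `0, 1, 2, 3` are east, north, west, south; adding `1` turns left. -/
abbrev Dir := ZMod 4

/-- The unit step in a given direction. -/
def step (d : Dir) : ℤ × ℤ :=
  if d = 0 then (1, 0) else if d = 1 then (0, 1) else if d = 2 then (-1, 0) else (0, -1)

/-- A direction as a unit complex number: `1, i, -1, -i`. -/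
noncomputable def dirC (d : Dir) : ℂ := Complex.I ^ d.val

/-- An oriented dual edge: the face it starts from, and its direction. -/
abbrev OEdge := Face × Dir

/-- The face from which an oriented dual edge starts. -/
def tail (a : OEdge) : Face := a.1

/-- The face to which an oriented dual edge points. If `z` is the midpoint of the edge and `o` its
orientation, this is the face `z + o / 2`. -/
def head (a : OEdge) : Face := a.1 + step a.2

/-- The same dual edge with the opposite orientation. -/
def rev (a : OEdge) : OEdge := (head a, a.2 + 2)

/-- The underlying unoriented dual edge. As edges of the square lattice, dual edges, and their
common midpoints correspond to each other, this also stands for the edge (midpoint) `z`. -/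
def edge (a : OEdge) : Sym2 Face := s(tail a, head a)

/-- `a` crosses an edge of the domain `Ω` (given by its finite set of faces): at least one of the
two faces next to that edge is a face of `Ω`. Boundary edges of `Ω` are included. -/
def IsEdgeOf (Ω : Finset Face) (a : OEdge) : Prop := tail a ∈ Ω ∨ head a ∈ Ω

/-- The set `ℰ*` of dual edges of `Ω`: pairs of adjacent faces of `Ω`. -/
def dualEdges (Ω : Finset Face) : Finset (Sym2 Face) :=
  ((Ω ×ˢ (Finset.univ : Finset Dir)).filter fun a => head a ∈ Ω).image edge

/-- The number of edges of `ω` that contain the face `p`. -/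
def degree (ω : Finset (Sym2 Face)) (p : Face) : ℕ := (ω.filter fun b => p ∈ b).card

/-- Closed contours: sets of dual edges with even degree at every face. -/
def contours (Ω : Finset Face) : Finset (Finset (Sym2 Face)) :=
  (dualEdges Ω).powerset.filter fun ω => ∀ p ∈ Ω, Even (degree ω p)

/-- The low temperature expansion parameter `α = e^{-2β}`. -/
noncomputable def alpha (β : ℝ) : ℝ := Real.exp (-2 * β)

/-- The low temperature partition function `𝒵 = ∑_{ω ∈ 𝒞} α^{|ω|}`. -/
noncomputable def partitionFn (Ω : Finset Face) (β : ℝ) : ℝ :=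
  ∑ ω ∈ contours Ω, alpha β ^ ω.card

section Observable

variable {k : ℕ}

/-- The configurations `γ` with the half-edges `⟨z_j, z_j + o_j / 2⟩`, where `(z_j, o_j)` is the
midpoint and the orientation of `e j`. Such a `γ` consists of these half-edges and of a set `ω` of
full dual edges of `Ω`; it is recorded by `ω`. Every half-edge must end at a face of `Ω` (so there
is no configuration if some `o_j` points out of `Ω`), the dual edges crossing the `z_j` are present
only through their halves, and every face of `Ω` belongs to an even number of edges and half-edges
of `γ`. -/
def configs (Ω : Finset Face) (e : Fin k → OEdge) : Finset (Finset (Sym2 Face)) :=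
  (dualEdges Ω).powerset.filter fun ω =>
    (∀ j, head (e j) ∈ Ω) ∧ (∀ j, edge (e j) ∉ ω) ∧
      ∀ p ∈ Ω, Even (degree ω p + (Finset.univ.filter fun j => head (e j) = p).card)

/-- `a` runs along the last half-edge of a path, from `z_j + o_j / 2` to `z_j`. -/
def EndsAt (e : Fin k → OEdge) (a : OEdge) (j : Fin k) : Prop := a = rev (e j)

/-- A path of `γ` can leave the face `tail a` in the direction of `a`: either the whole dual edge
`a` belongs to `γ`, or its first half is one of the half-edges of `γ`. -/
def Occupied (e : Fin k → OEdge) (ω : Finset (Sym2 Face)) (a : OEdge) : Prop :=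
  edge a ∈ ω ∨ ∃ j, EndsAt e a j

/-- A way to resolve ambiguities: for each set of edges and each face a value in `Bool`, which is
used only if the face belongs to four edges and half-edges of the configuration. The value `true`
means that there the east edge is linked to the north edge and the west edge to the south edge,
the value `false` that the north edge is linked to the west edge and the south edge to the east
edge. So at an ambiguity a path always turns left or right. -/
abbrev Resolution := Finset (Sym2 Face) → Face → Bool

open Classical in
/-- The turn, in units of `π / 2` and counterclockwise, that a path of the configuration makes at
the face `head a` when it arrives there along `a`. -/
noncomputable def turn (ρ : Resolution) (e : Fin k → OEdge) (ω : Finset (Sym2 Face))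
    (a : OEdge) : ℤ :=
  let l := Occupied e ω (head a, a.2 + 1)
  let r := Occupied e ω (head a, a.2 + 3)
  if l ∧ r then
    if (ρ ω (head a) = true ↔ a.2 = 1 ∨ a.2 = 3) then 1 else -1
  else if l then 1
  else if r then -1
  else 0

/-- The oriented dual edge that follows `a` on a path of the configuration. -/
noncomputable def next (ρ : Resolution) (e : Fin k → OEdge) (ω : Finset (Sym2 Face))
    (a : OEdge) : OEdge :=
  (head a, a.2 + ((turn ρ e ω a : ℤ) : ZMod 4))

/-- The `n`-th oriented dual edge of the path that starts from `z_s` along `e s`. -/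
noncomputable def pathEdge (ρ : Resolution) (e : Fin k → OEdge) (ω : Finset (Sym2 Face))
    (s : Fin k) (n : ℕ) : OEdge :=
  (next ρ e ω)^[n] (e s)

/-- The number of steps after which the path from `z_s` first arrives at some `z_j`. -/
noncomputable def pathLength (ρ : Resolution) (e : Fin k → OEdge) (ω : Finset (Sym2 Face))
    (s : Fin k) : ℕ :=
  sInf {n | ∃ j, EndsAt e (pathEdge ρ e ω s n) j}

/-- The path from `z_s` ends at `z_d`. -/
def Joined (ρ : Resolution) (e : Fin k → OEdge) (ω : Finset (Sym2 Face)) (s d : Fin k) : Prop :=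
  EndsAt e (pathEdge ρ e ω s (pathLength ρ e ω s)) d

/-- The winding `W(π)`, in radians, of the path `π` that starts from `z_s`. -/
noncomputable def winding (ρ : Resolution) (e : Fin k → OEdge) (ω : Finset (Sym2 Face))
    (s : Fin k) : ℝ :=
  (Real.pi / 2) *
    ((∑ n ∈ Finset.range (pathLength ρ e ω s), turn ρ e ω (pathEdge ρ e ω s n) : ℤ) : ℝ)

open Classical in
/-- The pairs `(s, d)`, `s < d`, such that a path of the configuration links `z_s` and `z_d`. -/
noncomputable def pairing (ρ : Resolution) (e : Fin k → OEdge) (ω : Finset (Sym2 Face)) :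
    Finset (Fin k × Fin k) :=
  Finset.univ.filter fun q => q.1 < q.2 ∧ Joined ρ e ω q.1 q.2

/-- The number of crossings of a set of pairs: the number of pairs of its elements `(s, d)`,
`(s', d')` with `s < s' < d < d'`. -/
def crossings (P : Finset (Fin k × Fin k)) : ℕ :=
  ((P ×ˢ P).filter fun q => q.1.1 < q.2.1 ∧ q.2.1 < q.1.2 ∧ q.1.2 < q.2.2).card

/-- The complex weight `sign(γ) ∏_{π : z_s ⇝ z_d} (ε_d / ε_s) e^{-(i/2) W(π)}`. -/
noncomputable def phase (ρ : Resolution) (e : Fin k → OEdge) (ε : Fin k → ℂ)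
    (ω : Finset (Sym2 Face)) : ℂ :=
  (-1) ^ crossings (pairing ρ e ω) *
    ∏ q ∈ pairing ρ e ω,
      ε q.2 / ε q.1 * Complex.exp (-(Complex.I / 2) * (winding ρ e ω q.1 : ℂ))

end Observable

/-- The multipoint parafermionic observable `f^ε(z_1, …, z_{2m})` of the domain `Ω` at inverse
temperature `β`, where `z_j` is the midpoint of the oriented dual edge `e j`. The length `L(γ)` is
the number of full edges plus `m`. -/
noncomputable def observable (Ω : Finset Face) (β : ℝ) (ρ : Resolution) {m : ℕ}
    (e : Fin (2 * m) → OEdge) (ε : Fin (2 * m) → ℂ) : ℂ :=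
  (1 / (partitionFn Ω β : ℂ)) *
    ∑ ω ∈ configs Ω e, (alpha β : ℂ) ^ (ω.card + m) * phase ρ e ε ω

/-- The two-point parafermionic observable `f^{(ε, ε')}(z, z')`. -/
noncomputable def observable₂ (Ω : Finset Face) (β : ℝ) (ρ : Resolution)
    (a b : OEdge) (ε ε' : ℂ) : ℂ :=
  observable (m := 1) Ω β ρ ![a, b] ![ε, ε']

/-- The Pfaffian `(1 / (2^m m!)) ∑_{σ ∈ S_{2m}} sgn(σ) ∏_{s=1}^m A_{σ(2s-1), σ(2s)}`, with indices
starting from `0` instead of `1`. -/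
noncomputable def pfaffian {m : ℕ} (A : Matrix (Fin (2 * m)) (Fin (2 * m)) ℂ) : ℂ :=
  (1 / ((2 : ℂ) ^ m * (m.factorial : ℂ))) *
    ∑ σ : Equiv.Perm (Fin (2 * m)), ((Equiv.Perm.sign σ : ℤ) : ℂ) *
      ∏ s : Fin m, A (σ ⟨2 * s, by omega⟩) (σ ⟨2 * s + 1, by omega⟩)

/-- The matrix `(f^{(ε_j, ε_k)}(z_j, z_k) 1_{j ≠ k})_{j,k}` of two-point observables. For each entry
the ambiguities may be resolved in a different way. -/
noncomputable def twoPointMatrix (Ω : Finset Face) (β : ℝ) {N : ℕ}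
    (ρ : Fin N → Fin N → Resolution) (e : Fin N → OEdge) (ε : Fin N → ℂ) :
    Matrix (Fin N) (Fin N) ℂ :=
  Matrix.of fun j k => if j ≠ k then observable₂ Ω β (ρ j k) (e j) (e k) (ε j) (ε k) else 0

end Parafermion

namespace Parafermion

open Polynomial

/-! ### Directions, oriented edges and degrees -/

/-! The complex phase of a configuration is, up to a factor common to all configurations with the
same marked edges, a real sign in which the paths no longer appear. Oriented dual edges are totally
ordered by `Prec`, and the spin at an edge is the parity of the horizontal domain walls below it in
a column. The sign `weight` is that of the permutation sorting the marked edges, times the spins at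
these edges. It is a Jordan-Wigner sign: `Prec` is arranged so that an edge `f` lies between `b` and
`rev b` exactly when removing the wall `b` flips the spin at `f` (`sgn_mul_spin_erase`). Hence a
mark can be moved through a wall, and at a face the factors of the four possible positions of a mark
differ only by signs read off from the occupation of that face (`exists_arcSign_eq`). Finite checks
match these signs with the turn of the path. Following the first path step by step,
`exists_pathSystem` and `phase_eq` identify the phase with `weight`, up to one factor `i` per path
and the choice of the square roots `ε`. The result does not involve the resolution of ambiguities
and is antisymmetric in the marks.

It remains to treat the sums of these signs, taken as polynomials `obsPoly` in the variable `α`. As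
a function of the first mark `a`, such a polynomial satisfies a linear relation at each face
(`obsPolyCons_eq`): the value at `a` is a combination of `α` times the values at the edges leaving
the face, plus a source for every other mark that points to the same face, namely a signed
polynomial with that mark removed. The product of the partition function with a multipoint
polynomial has the same sources as its expansion along the row of `a`. Their difference satisfies a
homogeneous relation with a factor `α` in every term, so all its coefficients vanish
(`eq_zero_of_local`). Uniqueness is thus purely formal, and the expansion `obsPoly_expansion` holds
at every value of `α`. Averaging it over all rows gives the Pfaffian. -/

lemma dir_cases (d : Dir) : d = 0 ∨ d = 1 ∨ d = 2 ∨ d = 3 := by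
  revert d; decide

@[simp] lemma step_zero : step 0 = (1, 0) := by decide
@[simp] lemma step_one : step 1 = (0, 1) := by decide
@[simp] lemma step_two : step 2 = (-1, 0) := by decide
@[simp] lemma step_three : step 3 = (0, -1) := by decide

lemma dir_facts : ((1 : Dir) ≠ 0 ∧ (2 : Dir) ≠ 0 ∧ (3 : Dir) ≠ 0 ∧ (1 : Dir) ≠ 3 ∧ (2 : Dir) ≠ 3 ∧
    (0 : Dir) ≠ 3 ∧ (1 : Dir) ≠ 2 ∧ (0 : Dir) ≠ 2 ∧ (3 : Dir) ≠ 2 ∧ (0 : Dir) ≠ 1 ∧ (2 : Dir) ≠ 1 ∧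
    (3 : Dir) ≠ 1) ∧ ((0 + 2 : Dir) = 2 ∧ (1 + 2 : Dir) = 3 ∧ (2 + 2 : Dir) = 0 ∧
    (3 + 2 : Dir) = 1) ∧ ((0 : Dir).val = 0 ∧ (1 : Dir).val = 1 ∧ (2 : Dir).val = 2 ∧
    (3 : Dir).val = 3) := by decide

lemma step_injective : Function.Injective step := by
  intro a b; revert a b; decide

lemma step_add_two (d : Dir) : step (d + 2) = -step d := by
  revert d; decide

lemma step_ne_zero (d : Dir) : step d ≠ 0 := by
  revert d; decide

/-- The oriented dual edge that arrives at the face `v` in the direction `d`. -/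
def inc (v : Face) (d : Dir) : OEdge := (v - step d, d)

@[simp] lemma head_inc (v : Face) (d : Dir) : head (inc v d) = v := by
  simp [head, inc]

@[simp] lemma inc_snd (v : Face) (d : Dir) : (inc v d).2 = d := rfl

lemma inc_head (a : OEdge) : inc (head a) a.2 = a := by
  simp [head, inc]

lemma eq_inc {a : OEdge} {v : Face} (h : head a = v) : a = inc v a.2 := by
  rw [← h, inc_head]

lemma inc_injective (v : Face) : Function.Injective (inc v) := fun _ _ h => congrArg Prod.snd h

@[simp] lemma rev_rev (a : OEdge) : rev (rev a) = a := by
  obtain ⟨p, d⟩ := a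
  have h4 : d + 2 + 2 = d := by revert d; decide
  simp [rev, head, step_add_two, h4]

@[simp] lemma head_rev (a : OEdge) : head (rev a) = tail a := by
  simp [rev, head, tail, step_add_two]

@[simp] lemma tail_rev (a : OEdge) : tail (rev a) = head a := rfl

@[simp] lemma rev_snd (a : OEdge) : (rev a).2 = a.2 + 2 := rfl

lemma rev_injective : Function.Injective rev := fun a b h => by
  simpa using congrArg rev h

@[simp] lemma edge_rev (a : OEdge) : edge (rev a) = edge a := by
  simp [edge, Sym2.eq_swap]

lemma rev_inc (v : Face) (d : Dir) : rev (inc v d) = (v, d + 2) := by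
  simp [rev]

lemma rev_ne (a : OEdge) : rev a ≠ a := by
  intro h
  have h2 : a.2 + 2 = a.2 := congrArg Prod.snd h
  revert h2; generalize a.2 = d; revert d; decide

lemma edge_eq_iff {a b : OEdge} : edge a = edge b ↔ a = b ∨ a = rev b := by
  constructor
  · intro h
    have key : ∀ c : OEdge, tail a = tail c → head a = head c → a = c := by
      intro c h1 h2
      simp only [head, tail] at h1 h2
      refine Prod.ext h1 (step_injective ?_)
      rw [h1] at h2
      exact add_left_cancel h2
    rcases Sym2.eq_iff.1 h with ⟨h1, h2⟩ | ⟨h1, h2⟩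
    · exact Or.inl (key b h1 h2)
    · exact Or.inr (key _ (by simpa using h1) (by simpa using h2))
  · rintro (rfl | rfl) <;> simp

lemma edge_inc_injective (v : Face) : Function.Injective fun d => edge (inc v d) := by
  intro d d' h
  rcases edge_eq_iff.1 h with h | h
  · exact inc_injective v h
  · have h1 := congrArg head h
    rw [head_inc, head_rev] at h1
    exact absurd (sub_eq_self.1 h1.symm) (step_ne_zero _)

lemma mem_edge_iff {v : Face} {a : OEdge} : v ∈ edge a ↔ tail a = v ∨ head a = v := by
  simp [edge, eq_comm]

lemma mem_dualEdges {Ω : Finset Face} {a : OEdge} :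
    edge a ∈ dualEdges Ω ↔ tail a ∈ Ω ∧ head a ∈ Ω := by
  simp only [dualEdges, Finset.mem_image, Finset.mem_filter, Finset.mem_product,
    Finset.mem_univ, and_true]
  constructor
  · rintro ⟨b, ⟨h1, h2⟩, h⟩
    rcases edge_eq_iff.1 h with rfl | rfl
    · exact ⟨h1, h2⟩
    · exact ⟨by simpa using h2, by simpa [tail, rev] using h1⟩
  · rintro ⟨h1, h2⟩
    exact ⟨a, ⟨h1, h2⟩, rfl⟩

lemma exists_edge_eq {Ω : Finset Face} {b : Sym2 Face} (hb : b ∈ dualEdges Ω) :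
    ∃ a, edge a = b := by
  obtain ⟨a, -, h⟩ := Finset.mem_image.1 hb
  exact ⟨a, h⟩

/-- The indicator that the edge at `v` in the direction `-d` belongs to `X`. -/
def edgeInd (X : Finset (Sym2 Face)) (v : Face) (d : Dir) : ℕ :=
  if edge (inc v d) ∈ X then 1 else 0

/-- The indicator that `inc v d` is one of the `e j`. -/
def markInd {k : ℕ} (e : Fin k → OEdge) (v : Face) (d : Dir) : ℕ :=
  if ∃ j, e j = inc v d then 1 else 0

lemma sum_dir {M : Type*} [AddCommMonoid M] (f : Dir → M) :
    ∑ d, f d = f 0 + f 1 + f 2 + f 3 := Fin.sum_univ_four f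

lemma degree_eq {Ω : Finset Face} {X : Finset (Sym2 Face)} (hX : X ⊆ dualEdges Ω) (v : Face) :
    degree X v = ∑ d, edgeInd X v d := by
  have : X.filter (fun b => v ∈ b)
      = (Finset.univ.filter fun d => edge (inc v d) ∈ X).image fun d => edge (inc v d) := by
    ext b
    simp only [Finset.mem_filter, Finset.mem_image, Finset.mem_univ, true_and]
    constructor
    · rintro ⟨hb, hv⟩
      obtain ⟨a, rfl⟩ := exists_edge_eq (hX hb)
      rcases mem_edge_iff.1 hv with h | h
      · have h' : rev a = inc v (rev a).2 := eq_inc (by simpa using h)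
        refine ⟨(rev a).2, ?_, ?_⟩ <;> rw [← h', edge_rev]
        exact hb
      · have h' := eq_inc h
        refine ⟨a.2, ?_, ?_⟩ <;> rw [← h']
        exact hb
    · rintro ⟨d, hd, rfl⟩
      exact ⟨hd, mem_edge_iff.2 (Or.inr (head_inc v d))⟩
  rw [degree, this, Finset.card_image_of_injective _ (edge_inc_injective v), Finset.card_filter]
  rfl

/-- The number of the `e j` that point to `v`. -/
def marks {k : ℕ} (e : Fin k → OEdge) (v : Face) : ℕ :=
  (Finset.univ.filter fun j => head (e j) = v).card

lemma marks_eq {k : ℕ} {e : Fin k → OEdge} (he : Function.Injective e) (v : Face) :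
    marks e v = ∑ d, markInd e v d := by
  have : (Finset.univ.filter fun d => ∃ j, e j = inc v d)
      = (Finset.univ.filter fun j => head (e j) = v).image fun j => (e j).2 := by
    ext d
    simp only [Finset.mem_filter, Finset.mem_image, Finset.mem_univ, true_and]
    constructor
    · rintro ⟨j, hj⟩
      exact ⟨j, by simp [hj], by simp [hj]⟩
    · rintro ⟨j, hj, rfl⟩
      exact ⟨j, eq_inc hj⟩
  have h2 : ∑ d, markInd e v d = (Finset.univ.filter fun d => ∃ j, e j = inc v d).card := by
    rw [Finset.card_filter]; rfl
  rw [h2, this, Finset.card_image_of_injOn, marks]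
  intro i hi j hj hij
  simp only [Finset.coe_filter, Finset.mem_univ, true_and, Set.mem_ofPred_eq] at hi hj
  apply he
  rw [eq_inc hi, eq_inc hj]
  exact congrArg _ hij

/-! ### The order on oriented edges -/

/-- A total order on oriented dual edges: by the abscissa of the head, then edges pointing east
before all others, then by the ordinate of the head (descending for edges pointing east), then by
the direction. -/
def Prec (a b : OEdge) : Prop :=
  (head a).1 < (head b).1 ∨ (head a).1 = (head b).1 ∧
    ((a.2 = 0 ∧ b.2 ≠ 0) ∨ (a.2 = 0 ∧ b.2 = 0 ∧ (head b).2 < (head a).2) ∨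
      (a.2 ≠ 0 ∧ b.2 ≠ 0 ∧ ((head a).2 < (head b).2 ∨
        (head a).2 = (head b).2 ∧ a.2.val < b.2.val)))

instance : DecidableRel Prec := fun a b => by unfold Prec; infer_instance

/-- The sign of the relative position of `a` and `b` in the order `Prec`. -/
def sgn (a b : OEdge) : ℤ := if Prec a b then 1 else -1

lemma sgn_mul_self (a b : OEdge) : sgn a b * sgn a b = 1 := by
  unfold sgn; split_ifs <;> rfl

lemma prec_swap {a b : OEdge} (h : a ≠ b) : Prec b a ↔ ¬ Prec a b := by
  by_cases hh : head a = head b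
  · have h2 : a.2 ≠ b.2 := fun h2 => h (by rw [← inc_head a, ← inc_head b, hh, h2])
    unfold Prec
    rw [hh]
    generalize a.2 = c at h2 ⊢
    generalize b.2 = d at h2 ⊢
    simp only [lt_irrefl, false_or, true_and, and_false]
    revert c d; decide
  · have h3 : (head a).1 ≠ (head b).1 ∨ (head a).2 ≠ (head b).2 := by
      by_contra h3
      push Not at h3
      exact hh (Prod.ext h3.1 h3.2)
    unfold Prec
    by_cases ha : a.2 = 0 <;> by_cases hb : b.2 = 0 <;> simp [ha, hb] <;> omega

lemma sgn_swap {a b : OEdge} (h : a ≠ b) : sgn b a = -sgn a b := by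
  unfold sgn
  simp only [prec_swap h]
  split_ifs <;> simp_all

/-! ### Spins -/

/-- The horizontal dual edge from `(x, y)` to `(x + 1, y)`. -/
def hEdge (x y : ℤ) : Sym2 Face := s((x, y), (x + 1, y))

open Classical in
/-- The number of horizontal edges of `X` in the column between `x` and `x + 1` that lie strictly
below the height `y`. -/
noncomputable def col (X : Finset (Sym2 Face)) (x y : ℤ) : ℕ :=
  (X.filter fun b => ∃ y' < y, b = hEdge x y').card

/-- The column and the height from which the spin at `a` is read. -/
def cell (a : OEdge) : ℤ × ℤ :=
  if a.2 = 0 then ((head a).1 - 1, (head a).2)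
  else if a.2 = 3 then ((head a).1, (head a).2 + 1) else head a

/-- The spin, with respect to the domain walls `X`, next to the edge crossed by `a`. -/
noncomputable def spin (a : OEdge) (X : Finset (Sym2 Face)) : ℤ :=
  (-1) ^ col X (cell a).1 (cell a).2

lemma spin_mul_self (a : OEdge) (X : Finset (Sym2 Face)) : spin a X * spin a X = 1 := by
  rw [spin, ← pow_add, ← two_mul, pow_mul]; simp

/-- Both orientations read the spin at the same end of the crossed primal edge: its lower end if it
is vertical, its right end if it is horizontal. -/
lemma cell_rev (a : OEdge) : cell (rev a) = cell a := by
  obtain ⟨⟨x, y⟩, d⟩ := a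
  rcases dir_cases d with rfl | rfl | rfl | rfl <;>
    simp [cell, rev, head, dir_facts, sub_eq_add_neg]

lemma spin_rev (a : OEdge) (X : Finset (Sym2 Face)) : spin (rev a) X = spin a X := by
  rw [spin, spin, cell_rev]

lemma hEdge_injective (x : ℤ) : Function.Injective (hEdge x) := by
  intro y y' h
  simp only [hEdge, Sym2.eq_iff, Prod.mk.injEq] at h
  omega

lemma col_erase (X : Finset (Sym2 Face)) {b : Sym2 Face} (hb : b ∈ X) (x y : ℤ) :
    ((-1 : ℤ)) ^ col (X.erase b) x y
      = (-1) ^ col X x y * by classical exact (if ∃ y' < y, b = hEdge x y' then -1 else 1) := by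
  classical
  unfold col
  rw [Finset.filter_erase]
  split_ifs with h
  · have hm : b ∈ X.filter fun b => ∃ y' < y, b = hEdge x y' := by simp [hb, h]
    rw [← Finset.card_erase_add_one hm, pow_succ]; ring
  · rw [Finset.erase_eq_of_notMem (by simp [h])]; ring

/-- Vertical walls are never counted, and a horizontal edge lies at the height of its own cell,
whereas only walls strictly below are counted. -/
lemma spin_erase_self {a : OEdge} {X : Finset (Sym2 Face)} (ha : edge a ∈ X) :
    spin a (X.erase (edge a)) = spin a X := by
  classical
  rw [spin, spin, col_erase X ha, if_neg, mul_one]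
  obtain ⟨⟨x, y⟩, d⟩ := a
  rintro ⟨y', hy, h⟩
  rcases dir_cases d with rfl | rfl | rfl | rfl <;>
    simp [cell, edge, head, tail, hEdge, dir_facts] at h hy <;> omega

/-- Erasing `b` changes the spin at `f` exactly when `f` lies between `b` and `rev b` in the order.
For vertical `b` nothing lies between the two orientations. For horizontal `b` the edges in between
are those whose cell is in the same column and higher; the descending rule for edges pointing east
serves this purpose. -/
lemma sgn_mul_spin_erase {b f : OEdge} {X : Finset (Sym2 Face)} (hb : edge b ∈ X)
    (hf : edge f ≠ edge b) :
    sgn b f * spin f (X.erase (edge b)) = sgn (rev b) f * spin f X := by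
  classical
  rw [spin, spin, col_erase X hb]
  have hne : f ≠ b ∧ f ≠ rev b := by
    rw [← not_or]; exact fun h => hf (edge_eq_iff.2 h)
  suffices h : sgn b f * (if ∃ y' < (cell f).2, edge b = hEdge (cell f).1 y' then -1 else 1)
      = sgn (rev b) f by
    rw [← h]; ring
  -- The wall `b` is counted at `f` when it is horizontal and its cell lies below that of `f` in the
  -- same column; after this only the order remains to be compared, for each pair of directions.
  have hiff : (∃ y' < (cell f).2, edge b = hEdge (cell f).1 y') ↔
      (b.2 = 0 ∨ b.2 = 2) ∧ (cell b).1 = (cell f).1 ∧ (cell b).2 < (cell f).2 := by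
    generalize cell f = c
    obtain ⟨⟨x, y⟩, d⟩ := b
    obtain ⟨p, q⟩ := c
    constructor
    · rintro ⟨y', hy, h⟩
      rcases dir_cases d with rfl | rfl | rfl | rfl <;>
        simp [cell, edge, head, tail, hEdge, dir_facts] at h hy ⊢ <;> omega
    · rintro ⟨h1, h2, h3⟩
      rcases h1 with rfl | rfl <;> simp [cell, head, dir_facts] at h2 h3 <;>
        refine ⟨y, h3, ?_⟩ <;> simp [edge, head, tail, hEdge] <;> omega
  rw [if_congr hiff rfl rfl]
  have hne' : head f = head b → f.2 ≠ b.2 := fun h1 h2 => hne.1 <| by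
    rw [← inc_head f, ← inc_head b, h1, h2]
  have hne2 : head f = tail b → f.2 ≠ b.2 + 2 := fun h1 h2 => hne.2 <| by
    rw [← inc_head f, ← inc_head (rev b), head_rev, h1, h2, rev_snd]
  simp only [cell, sgn, Prec, head_rev, rev_snd]
  clear hiff hne hf hb
  obtain ⟨⟨x, y⟩, d⟩ := b
  obtain ⟨⟨z, t⟩, c⟩ := f
  rcases dir_cases d with rfl | rfl | rfl | rfl <;> rcases dir_cases c with rfl | rfl | rfl | rfl <;>
    simp [dir_facts, head, tail] at hne' hne2 ⊢ <;> split_ifs <;> first | rfl | omega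

/-! ### The real sign of a configuration -/

/-- The sign of a configuration in terms of its domain walls: the sign of the permutation that sorts
the marked edges, times the product of the spins next to them. -/
noncomputable def weight {k : ℕ} (e : Fin k → OEdge) (X : Finset (Sym2 Face)) : ℤ :=
  (∏ i, ∏ j, if i < j then sgn (e i) (e j) else 1) * ∏ i, spin (e i) X

/-- The factor by which the weight is multiplied when the edge `c` is put before the `e j`. -/
noncomputable def arcSign {k : ℕ} (e : Fin k → OEdge) (X : Finset (Sym2 Face)) (c : OEdge) : ℤ :=
  spin c X * ∏ i, if e i = c then 1 else sgn c (e i)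

/-- Exactly `j` of the remaining indices lie below `j`. -/
lemma prod_neg_one_succAbove {k : ℕ} (j : Fin (k + 1)) :
    ∏ i : Fin k, (if j < j.succAbove i then (1 : ℤ) else -1) = (-1) ^ (j : ℕ) := by
  have h : ∀ i : Fin k, (if j < j.succAbove i then (1 : ℤ) else -1)
      = if (i : ℕ) < j then -1 else 1 := by
    intro i
    simp only [Fin.lt_succAbove_iff_le_castSucc, Fin.le_def, Fin.val_castSucc]
    split_ifs <;> first | rfl | omega
  have hj : (Finset.univ.filter fun i : Fin k => (i : ℕ) < j).card = j := by
    have := @Fin.card_filter_val_lt k j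
    omega
  rw [Finset.prod_congr rfl fun i _ => h i, Finset.prod_ite]
  simp [hj]

/-- Bringing `e j` to the front reverses its pairs with the `j` earlier marks, and each reversal
costs one sign. -/
lemma weight_succAbove {k : ℕ} {e : Fin (k + 1) → OEdge} (he : Function.Injective e)
    (X : Finset (Sym2 Face)) (j : Fin (k + 1)) :
    weight e X
      = (-1) ^ (j : ℕ) * arcSign (e ∘ j.succAbove) X (e j) * weight (e ∘ j.succAbove) X := by
  have hne : ∀ i, e (j.succAbove i) ≠ e j := fun i h => Fin.succAbove_ne j i (he h)
  have h1 : ∏ i : Fin k, ((if j < j.succAbove i then sgn (e j) (e (j.succAbove i)) else 1) *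
      (if j.succAbove i < j then sgn (e (j.succAbove i)) (e j) else 1))
      = (-1) ^ (j : ℕ) * ∏ i, sgn (e j) (e (j.succAbove i)) := by
    rw [← prod_neg_one_succAbove, ← Finset.prod_mul_distrib]
    refine Finset.prod_congr rfl fun i _ => ?_
    rcases lt_or_gt_of_ne (Fin.succAbove_ne j i) with h | h
    · rw [if_neg h.not_gt, if_pos h, if_neg h.not_gt, sgn_swap (hne i).symm]; ring
    · rw [if_pos h, if_neg h.not_gt, if_pos h]; ring
  simp only [weight, arcSign, Fin.prod_univ_succAbove _ j, lt_irrefl, if_false, one_mul,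
    Finset.prod_mul_distrib, Function.comp_apply, Fin.succAbove_lt_succAbove_iff, if_neg (hne _)]
  rw [Finset.prod_mul_distrib] at h1
  linear_combination (∏ i : Fin k, ∏ j_1 : Fin k,
    (if i < j_1 then sgn (e (j.succAbove i)) (e (j.succAbove j_1)) else 1)) * spin (e j) X *
      (∏ i, spin (e (j.succAbove i)) X) * h1

lemma weight_cons {k : ℕ} {a : OEdge} {e : Fin k → OEdge} (he : Function.Injective e)
    (ha : ∀ j, e j ≠ a) (X : Finset (Sym2 Face)) :
    weight (Fin.cons a e : Fin (k + 1) → OEdge) X = arcSign e X a * weight e X := by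
  rw [weight_succAbove (Fin.cons_injective_iff.2 ⟨fun ⟨j, hj⟩ => ha j hj, he⟩) X 0]
  have : (Fin.cons a e : Fin (k + 1) → OEdge) ∘ (0 : Fin (k + 1)).succAbove = e := by
    ext1 i; simp
  rw [this]; simp

/-- This moves a mark through an edge: a mark `b` with the wall erased has the same sign as a mark
`rev b` with the wall kept. It is `sgn_mul_spin_erase` multiplied over the other marks, the spin at
`b` itself being unaffected. -/
lemma arcSign_erase_mul_weight {k : ℕ} {e : Fin k → OEdge} {b : OEdge} {X : Finset (Sym2 Face)}
    (hb : edge b ∈ X) (he : ∀ j, edge (e j) ≠ edge b) :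
    arcSign e (X.erase (edge b)) b * weight e (X.erase (edge b))
      = arcSign e X (rev b) * weight e X := by
  have h1 : ∀ j, e j ≠ b := fun j h => he j (by rw [h])
  have h2 : ∀ j, e j ≠ rev b := fun j h => he j (by rw [h, edge_rev])
  have h3 : (∏ i, sgn b (e i)) * ∏ i, spin (e i) (X.erase (edge b))
      = (∏ i, sgn (rev b) (e i)) * ∏ i, spin (e i) X := by
    rw [← Finset.prod_mul_distrib, ← Finset.prod_mul_distrib]
    exact Finset.prod_congr rfl fun i _ => sgn_mul_spin_erase hb (he i)
  simp only [arcSign, weight, if_neg (h1 _), if_neg (h2 _), spin_erase_self hb, spin_rev]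
  linear_combination spin b X * (∏ i, ∏ j, if i < j then sgn (e i) (e j) else 1) * h3

/-! ### The sum rule along a column -/

lemma col_succ (X : Finset (Sym2 Face)) (x y : ℤ) :
    col X x (y + 1) = col X x y + if hEdge x y ∈ X then 1 else 0 := by
  classical
  unfold col
  have : (X.filter fun b => ∃ y' < y + 1, b = hEdge x y')
      = (X.filter fun b => ∃ y' < y, b = hEdge x y') ∪ X.filter fun b => b = hEdge x y := by
    rw [← Finset.filter_or]
    refine Finset.filter_congr fun b _ => ?_
    constructor
    · rintro ⟨y', hy, rfl⟩
      rcases (Int.lt_add_one_iff.1 hy).lt_or_eq with h | rfl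
      · exact Or.inl ⟨y', h, rfl⟩
      · exact Or.inr rfl
    · rintro (⟨y', hy, rfl⟩ | rfl)
      · exact ⟨y', by omega, rfl⟩
      · exact ⟨y, by omega, rfl⟩
  rw [this, Finset.card_union_of_disjoint]
  · congr 1
    rw [Finset.filter_eq']
    split_ifs <;> simp
  · rw [Finset.disjoint_filter]
    rintro b - ⟨y', hy, rfl⟩ h
    exact hy.ne (hEdge_injective x h)

lemma edgeInd_zero (X : Finset (Sym2 Face)) (x y : ℤ) :
    edgeInd X (x, y) 0 = if hEdge (x - 1) y ∈ X then 1 else 0 := by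
  simp [edgeInd, inc, edge, head, tail, hEdge]

lemma edgeInd_two (X : Finset (Sym2 Face)) (x y : ℤ) :
    edgeInd X (x, y) 2 = if hEdge x y ∈ X then 1 else 0 := by
  have h : edge (inc (x, y) 2) = hEdge x y := by simp [inc, edge, head, tail, hEdge, Sym2.eq_swap]
  rw [edgeInd, h]

lemma edgeInd_one_succ (X : Finset (Sym2 Face)) (x y : ℤ) :
    edgeInd X (x, y + 1) 1 = edgeInd X (x, y) 3 := by
  simp [edgeInd, inc, edge, head, tail, Sym2.eq_swap]

/-- The number of the `e j` that point to a face of the column `x` strictly below the height `y`. -/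
def lowMarks {k : ℕ} (e : Fin k → OEdge) (x y : ℤ) : ℕ :=
  (Finset.univ.filter fun j => (head (e j)).1 = x ∧ (head (e j)).2 < y).card

lemma lowMarks_succ {k : ℕ} (e : Fin k → OEdge) (x y : ℤ) :
    lowMarks e x (y + 1) = lowMarks e x y + marks e (x, y) := by
  unfold lowMarks marks
  rw [← Finset.card_union_of_disjoint]
  · congr 1
    ext j
    simp only [Finset.mem_filter, Finset.mem_univ, true_and, Finset.mem_union, Prod.ext_iff]
    omega
  · rw [Finset.disjoint_filter]
    rintro j - ⟨-, h⟩ h'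
    rw [h'] at h
    exact lt_irrefl _ h

/-- This is the sum of the parity conditions over the faces below `(x, y)` in one column of faces.
Vertical walls between consecutive faces count twice, which leaves the horizontal walls on both
sides, the marks, and the vertical wall just under `(x, y)`. The sum starts below `Ω`, where
everything vanishes. -/
lemma col_parity {Ω : Finset Face} {X : Finset (Sym2 Face)} (hX : X ⊆ dualEdges Ω) {k : ℕ}
    {e : Fin k → OEdge} (hΩ : ∀ j, head (e j) ∈ Ω) (x y : ℤ)
    (hpar : ∀ y' < y, Even (degree X (x, y') + marks e (x, y'))) :
    Even (col X (x - 1) y + col X x y + edgeInd X (x, y) 1 + lowMarks e x y) := by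
  classical
  obtain ⟨y₀, hy₀⟩ : ∃ y₀ : ℤ, ∀ p ∈ Ω, y₀ ≤ p.2 := by
    obtain ⟨y₀, h⟩ := (Ω.image Prod.snd).bddBelow
    exact ⟨y₀, fun p hp => h (by simpa using ⟨p.1, hp⟩)⟩
  have hcol : ∀ x y, y ≤ y₀ → col X x y = 0 := by
    intro x y hy
    rw [col, Finset.card_eq_zero, Finset.filter_eq_empty_iff]
    rintro b hb ⟨y', hy', rfl⟩
    have : edge ((x, y'), 0) ∈ dualEdges Ω := by
      have h : edge ((x, y'), 0) = hEdge x y' := by simp [edge, head, tail, hEdge]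
      rw [h]; exact hX hb
    have := hy₀ _ (mem_dualEdges.1 this).1
    simp only [tail] at this
    omega
  have hlow : ∀ y ≤ y₀, Even (col X (x - 1) y + col X x y + edgeInd X (x, y) 1 + lowMarks e x y) := by
    intro y hy
    have h1 : edgeInd X (x, y) 1 = 0 := by
      rw [edgeInd, if_neg]
      intro h
      have := hy₀ _ (mem_dualEdges.1 (hX h)).1
      simp only [tail, inc, step_one] at this
      simp at this
      omega
    have h2 : lowMarks e x y = 0 := by
      rw [lowMarks, Finset.card_eq_zero, Finset.filter_eq_empty_iff]
      rintro j - ⟨-, h⟩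
      have := hy₀ _ (hΩ j)
      omega
    simp [hcol _ _ hy, h1, h2]
  rcases le_total y y₀ with h | h
  · exact hlow y h
  · induction y, h using Int.leInduction with
    | base => exact hlow y₀ le_rfl
    | succ y h ih =>
      have h1 := ih fun y' hy' => hpar y' (by omega)
      have h2 := hpar y (by omega)
      rw [degree_eq hX, sum_dir, edgeInd_zero, edgeInd_two] at h2
      rw [col_succ, col_succ, lowMarks_succ, edgeInd_one_succ]
      have h3 := h1.add h2
      rw [Nat.even_iff] at h3 ⊢
      omega

/-! ### The factors of the four edges at a face -/

/-- The exponents that govern the factors `arcSign e X (inc v d)` at a face `v`. -/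
def locExp (x m : Dir → ℕ) (d : Dir) : ℕ :=
  if d = 0 then x 1 else if d = 1 then m 0 else if d = 2 then m 0 + m 1
  else m 0 + m 1 + m 2 + x 2

lemma prod_markInd {k : ℕ} {e : Fin k → OEdge} (he : Function.Injective e) (v : Face) (d : Dir) :
    ∏ i, (if e i = inc v d then (-1 : ℤ) else 1) = (-1) ^ markInd e v d := by
  unfold markInd
  split_ifs with h
  · obtain ⟨j, hj⟩ := h
    have : ∀ i, (if e i = inc v d then (-1 : ℤ) else 1) = if i = j then -1 else 1 := by
      intro i
      rw [← hj]; simp [he.eq_iff]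
    simp [this]
  · push Not at h
    simp [h]

/-- In the order, `inc v 0` and `inc v 1` are separated, away from `v`, exactly by the edges
pointing to lower faces of the same abscissa. The resulting sign will cancel `lowMarks` in
`col_parity`. -/
lemma sgn_inc_zero (v : Face) (f : OEdge) :
    (if f = inc v 0 then 1 else sgn (inc v 0) f) = (if head f = v then 1 else sgn (inc v 1) f)
      * if (head f).1 = v.1 ∧ (head f).2 < v.2 then -1 else 1 := by
  by_cases hf : head f = v
  · rw [eq_inc hf]
    generalize f.2 = c
    rcases dir_cases c with rfl | rfl | rfl | rfl <;>
      simp [sgn, Prec, dir_facts, (inc_injective v).eq_iff]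
  · rw [if_neg (fun h => hf (by rw [h, head_inc])), if_neg hf]
    simp only [sgn, Prec, head_inc, inc_snd]
    have hf' : ¬ ((head f).1 = v.1 ∧ (head f).2 = v.2) := fun h => hf (Prod.ext h.1 h.2)
    clear hf
    generalize head f = p at *
    rcases dir_cases f.2 with h | h | h | h <;> simp [h, dir_facts] <;>
      split_ifs <;> first | rfl | omega

lemma sgn_inc_of_ne {v : Face} {d : Dir} (hd : d ≠ 0) {f : OEdge} (hf : head f ≠ v) :
    sgn (inc v d) f = sgn (inc v 1) f := by
  have hf' : (head f).1 = v.1 → (head f).2 ≠ v.2 := fun h h' => hf (Prod.ext h h')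
  simp only [sgn, Prec, head_inc, inc_snd]
  generalize f.2 = c
  generalize head f = p at *
  congr 1
  simp only [eq_iff_iff]
  simp only [hd, dir_facts.1.1, false_and, false_or, ne_eq, not_false_eq_true, true_and]
  have h1 : v.1 = p.1 → v.2 ≠ p.2 := fun h h' => hf' h.symm h'.symm
  tauto

/-- The common factor `B` consists of the spin of the column to the right of `v` and of the
positions of the marks away from `v`. Marks at `v` contribute according to the order of directions.
The direction `0` reads the spin in the column on the left, which `col_parity` compensates up to the
wall below `v`; the direction `3` reads one unit higher and therefore also counts the wall to the
right of `v`. -/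
lemma exists_arcSign_eq {Ω : Finset Face} {X : Finset (Sym2 Face)} (hX : X ⊆ dualEdges Ω) {k : ℕ}
    {e : Fin k → OEdge} (he : Function.Injective e) (hΩ : ∀ j, head (e j) ∈ Ω) {v : Face}
    (hpar : ∀ p ≠ v, Even (degree X p + marks e p)) :
    ∃ B : ℤ, B * B = 1 ∧ ∀ d,
      arcSign e X (inc v d) = B * (-1) ^ locExp (edgeInd X v) (markInd e v) d := by
  obtain ⟨x, y⟩ := v
  have hcol := col_parity hX hΩ x y fun y' hy' => hpar _ fun h => hy'.ne (congrArg Prod.snd h)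
  set v : Face := (x, y) with hv
  set p : Fin k → ℤ := fun i => if head (e i) = v then 1 else sgn (inc v 1) (e i) with hp
  have hmark : ∀ d c, d ≠ 0 → (if inc v c = inc v d then (1 : ℤ) else sgn (inc v d) (inc v c))
      = if c.val < d.val then -1 else 1 := by
    intro d c hd
    simp only [(inc_injective v).eq_iff, sgn, Prec, head_inc, inc_snd, lt_irrefl, false_or, true_and,
      and_false]
    revert d c; decide
  have hcase : ∀ d i, d ≠ 0 → (if e i = inc v d then (1 : ℤ) else sgn (inc v d) (e i))
      = p i * if head (e i) = v ∧ (e i).2.val < d.val then -1 else 1 := by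
    intro d i hd
    by_cases hi : head (e i) = v
    · have := hmark d (e i).2 hd
      rw [← eq_inc hi] at this
      rw [this]; simp [hp, hi]
    · rw [if_neg (fun h => hi (by rw [h, head_inc])), sgn_inc_of_ne hd hi]
      simp [hp, hi]
  have hinc : ∀ i c, e i = inc v c ↔ head (e i) = v ∧ (e i).2 = c := by
    intro i c
    constructor
    · intro h; rw [h]; simp
    · rintro ⟨h, rfl⟩; exact eq_inc h
  refine ⟨(-1) ^ col X x y * ∏ i, p i, ?_, fun d => ?_⟩
  · rw [mul_mul_mul_comm, ← pow_add, ← two_mul, pow_mul, ← Finset.prod_mul_distrib]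
    have : ∀ i, p i * p i = 1 := by
      intro i; simp only [hp]; split_ifs
      · rfl
      · exact sgn_mul_self _ _
    simp [this]
  · by_cases hd : d = 0
    · subst hd
      have h1 : ∏ i, (if e i = inc v 0 then 1 else sgn (inc v 0) (e i))
          = (∏ i, p i) * (-1) ^ lowMarks e x y := by
        rw [Finset.prod_congr rfl fun i _ => sgn_inc_zero v (e i), Finset.prod_mul_distrib]
        congr 1
        rw [Finset.prod_ite]; simp [lowMarks, hv]
      -- The column on the left is traded for the one on the right, so the sign of the lower marks
      -- disappears.
      have h2 : (-1 : ℤ) ^ col X (x - 1) y * (-1) ^ lowMarks e x y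
          = (-1) ^ col X x y * (-1) ^ edgeInd X v 1 := by
        rw [← pow_add, ← pow_add]
        rw [Nat.even_iff] at hcol
        rw [neg_one_pow_eq_pow_mod_two, neg_one_pow_eq_pow_mod_two (_ + edgeInd X v 1)]
        congr 1; omega
      rw [arcSign, h1, spin]
      simp only [cell, head_inc, inc_snd, if_true, locExp]
      linear_combination (∏ i, p i) * h2
    · have h1 : ∏ i, (if e i = inc v d then 1 else sgn (inc v d) (e i))
          = (∏ i, p i) * ∏ i, if head (e i) = v ∧ (e i).2.val < d.val then -1 else 1 := by
        rw [Finset.prod_congr rfl fun i _ => hcase d i hd, Finset.prod_mul_distrib]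
      rw [arcSign, h1, spin]
      -- A mark at `v` precedes `inc v d` when its direction has a smaller value; this splits into
      -- one indicator for each smaller value.
      have hq : ∀ i, (if head (e i) = v ∧ (e i).2.val < d.val then (-1 : ℤ) else 1)
          = (if e i = inc v 0 then -1 else 1) * (if d.val ≤ 1 then 1 else
            (if e i = inc v 1 then -1 else 1) * (if d.val ≤ 2 then 1 else
              if e i = inc v 2 then -1 else 1)) := by
        intro i
        simp only [hinc]
        by_cases hi : head (e i) = v
        · simp only [hi, true_and]
          generalize (e i).2 = c
          clear h1
          revert c d; decide
        · simp [hi]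
      rw [Finset.prod_congr rfl fun i _ => hq i, Finset.prod_mul_distrib, prod_markInd he]
      have hv2 : ¬ (2 : Dir).val ≤ 1 ∧ (2 : Dir).val ≤ 2 ∧ ¬ (3 : Dir).val ≤ 1 ∧
        ¬ (3 : Dir).val ≤ 2 ∧ (1 : Dir).val ≤ 1 := by decide
      rcases dir_cases d with rfl | rfl | rfl | rfl
      · exact absurd rfl hd
      · simp [cell, locExp, dir_facts, hv]
        ring
      · simp only [hv2, if_true, if_false, mul_one, prod_markInd he]
        simp [cell, locExp, dir_facts, hv, pow_add]
        ring
      · simp only [hv2, if_false, Finset.prod_mul_distrib, prod_markInd he]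
        simp only [cell, locExp, dir_facts, hv, pow_add, col_succ, edgeInd_two, head_inc, inc_snd,
          if_false, if_true]
        ring

/-! ### Configurations -/

section Configs

variable {Ω : Finset Face} {k : ℕ}

lemma mem_configs {e : Fin k → OEdge} {X : Finset (Sym2 Face)} :
    X ∈ configs Ω e ↔ X ⊆ dualEdges Ω ∧ (∀ j, head (e j) ∈ Ω) ∧ (∀ j, edge (e j) ∉ X) ∧
      ∀ p ∈ Ω, Even (degree X p + marks e p) := by
  simp [configs, marks]

lemma degree_of_notMem {X : Finset (Sym2 Face)} (hX : X ⊆ dualEdges Ω) {p : Face} (hp : p ∉ Ω) :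
    degree X p = 0 := by
  rw [degree, Finset.card_eq_zero, Finset.filter_eq_empty_iff]
  intro b hb hpb
  obtain ⟨a, rfl⟩ := exists_edge_eq (hX hb)
  have h := mem_dualEdges.1 (hX hb)
  rcases mem_edge_iff.1 hpb with rfl | rfl
  · exact hp h.1
  · exact hp h.2

lemma marks_of_notMem {e : Fin k → OEdge} (hΩ : ∀ j, head (e j) ∈ Ω) {p : Face} (hp : p ∉ Ω) :
    marks e p = 0 := by
  rw [marks, Finset.card_eq_zero, Finset.filter_eq_empty_iff]
  rintro j - rfl
  exact hp (hΩ j)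

lemma even_of_mem_configs {e : Fin k → OEdge} {X : Finset (Sym2 Face)} (h : X ∈ configs Ω e)
    (p : Face) : Even (degree X p + marks e p) := by
  obtain ⟨h1, h2, -, h4⟩ := mem_configs.1 h
  by_cases hp : p ∈ Ω
  · exact h4 p hp
  · simp [degree_of_notMem h1 hp, marks_of_notMem h2 hp]

lemma degree_erase {X : Finset (Sym2 Face)} {b : Sym2 Face} (hb : b ∈ X) (p : Face) :
    degree (X.erase b) p + (if p ∈ b then 1 else 0) = degree X p := by
  unfold degree
  rw [Finset.filter_erase]
  split_ifs with h
  · exact Finset.card_erase_add_one (by simp [hb, h])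
  · rw [Finset.erase_eq_of_notMem (by simp [h])]; rfl

lemma marks_cons (a : OEdge) (e : Fin k → OEdge) (p : Face) :
    marks (Fin.cons a e : Fin (k + 1) → OEdge) p = marks e p + if head a = p then 1 else 0 := by
  simp only [marks, Finset.card_filter, Fin.sum_univ_succ, Fin.cons_zero, Fin.cons_succ]
  ring

lemma marks_succAbove (e : Fin (k + 1) → OEdge) (j : Fin (k + 1)) (p : Face) :
    marks e p = marks (e ∘ j.succAbove) p + if head (e j) = p then 1 else 0 := by
  simp only [marks, Finset.card_filter, Fin.sum_univ_succAbove _ j, Function.comp_apply]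
  ring

/-- Edge sets that are configurations except for a wrong parity at `v`. -/
def oddConfigs (Ω : Finset Face) (e : Fin k → OEdge) (v : Face) : Finset (Finset (Sym2 Face)) :=
  (dualEdges Ω).powerset.filter fun X =>
    (∀ j, edge (e j) ∉ X) ∧ ∀ p ∈ Ω, (Even (degree X p + marks e p) ↔ p ≠ v)

lemma mem_oddConfigs {e : Fin k → OEdge} {v : Face} {X : Finset (Sym2 Face)} :
    X ∈ oddConfigs Ω e v ↔ X ⊆ dualEdges Ω ∧ (∀ j, edge (e j) ∉ X) ∧
      ∀ p ∈ Ω, (Even (degree X p + marks e p) ↔ p ≠ v) := by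
  simp [oddConfigs]

/-- A further mark changes the required parity only at the face to which it points. -/
lemma configs_cons {e : Fin k → OEdge} (hΩ : ∀ j, head (e j) ∈ Ω) {a : OEdge} (ha : head a ∈ Ω) :
    configs Ω (Fin.cons a e : Fin (k + 1) → OEdge)
      = (oddConfigs Ω e (head a)).filter fun X => edge a ∉ X := by
  ext X
  simp only [mem_configs, Finset.mem_filter, mem_oddConfigs, Fin.forall_fin_succ, Fin.cons_zero,
    Fin.cons_succ, marks_cons, ← add_assoc]
  have : ∀ p, (Even (degree X p + marks e p + if head a = p then 1 else 0) ↔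
      (Even (degree X p + marks e p) ↔ p ≠ head a)) := by
    intro p
    by_cases h : head a = p
    · simp [h, Nat.even_add_one]
    · simp [h, Ne.symm h]
  simp only [this]
  tauto

/-- Erasing `c` repairs the parity at its head and spoils it at its tail, where the new mark `rev c`
restores it. -/
lemma erase_mem_configs_cons_rev {e : Fin k → OEdge} (hΩ : ∀ j, head (e j) ∈ Ω) {c : OEdge}
    {X : Finset (Sym2 Face)} (hc : edge c ∈ X) (hX : X ∈ oddConfigs Ω e (head c)) :
    X.erase (edge c) ∈ configs Ω (Fin.cons (rev c) e : Fin (k + 1) → OEdge) := by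
  obtain ⟨h1, h2, h3⟩ := mem_oddConfigs.1 hX
  refine mem_configs.2 ⟨(Finset.erase_subset _ _).trans h1, ?_, ?_, fun p hp => ?_⟩
  · rw [Fin.forall_fin_succ]
    exact ⟨by simpa using (mem_dualEdges.1 (h1 hc)).1, by simpa using hΩ⟩
  · rw [Fin.forall_fin_succ]
    exact ⟨by simp, fun i h => h2 i (by simpa using Finset.mem_of_mem_erase h)⟩
  · have h4 := degree_erase hc p
    have h5 := h3 p hp
    have hne : tail c ≠ head c := by simp [tail, head, step_ne_zero]
    rw [marks_cons, head_rev]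
    simp only [mem_edge_iff] at h4
    by_cases ht : tail c = p
    · have : p ≠ head c := by rw [← ht]; exact hne
      simp only [ht, true_or, if_true] at h4 ⊢
      rw [← h4] at h5
      simpa [this, add_assoc, add_comm, add_left_comm] using h5
    · by_cases hh : head c = p
      · simp only [hh, ht, or_true, if_true, if_false] at h4 ⊢
        rw [← h4, show degree (X.erase (edge c)) p + 1 + marks e p
          = degree (X.erase (edge c)) p + marks e p + 1 by ring, Nat.even_add_one] at h5
        simpa [hh] using h5
      · simp only [ht, hh, or_self, if_false, add_zero] at h4 ⊢
        rw [h4]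
        exact h5.2 (Ne.symm hh)

lemma mem_oddConfigs_of_erase {e : Fin k → OEdge} {c : OEdge} (he : ∀ j, edge (e j) ≠ edge c)
    (hv : head c ∈ Ω) {X : Finset (Sym2 Face)} (hc : edge c ∈ X)
    (hX : X.erase (edge c) ∈ configs Ω (Fin.cons (rev c) e : Fin (k + 1) → OEdge)) :
    X ∈ oddConfigs Ω e (head c) := by
  obtain ⟨h1, h2, h3, -⟩ := mem_configs.1 hX
  have h5 := even_of_mem_configs hX
  simp only [Fin.forall_fin_succ, Fin.cons_zero, Fin.cons_succ, edge_rev, head_rev,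
    Finset.mem_erase, not_and, marks_cons] at h2 h3 h5
  refine mem_oddConfigs.2 ⟨fun b hb => ?_, fun j hj => h3.2 j (he j) hj, fun p _ => ?_⟩
  · by_cases h : b = edge c
    · rw [h]; exact mem_dualEdges.2 ⟨h2.1, hv⟩
    · exact h1 (Finset.mem_erase.2 ⟨h, hb⟩)
  · have h4 := degree_erase hc p
    have h6 := h5 p
    have hne : tail c ≠ head c := by simp [tail, head, step_ne_zero]
    simp only [mem_edge_iff] at h4
    rw [← h4]
    by_cases ht : tail c = p
    · have : p ≠ head c := by rw [← ht]; exact hne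
      simp only [ht, true_or, if_true] at h6 ⊢
      simpa [this, add_assoc, add_comm, add_left_comm] using h6
    · by_cases hh : head c = p
      · simp only [hh, ht, or_true, if_true, if_false, add_zero] at h6 ⊢
        rw [show degree (X.erase (edge c)) p + 1 + marks e p
          = degree (X.erase (edge c)) p + marks e p + 1 by ring, Nat.even_add_one]
        simpa [hh] using h6
      · simp only [ht, hh, or_self, if_false, add_zero] at h6 ⊢
        simpa [Ne.symm hh] using h6

end Configs

/-! ### The local relation at a face -/

/-- The generating polynomial of the real signs of the configurations. -/
noncomputable def obsPoly (Ω : Finset Face) {k : ℕ} (e : Fin k → OEdge) : ℤ[X] :=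
  ∑ ω ∈ configs Ω e, C (weight e ω) * X ^ ω.card

/-- `obsPoly` with the additional edge `a`, which is put before the `e j`. -/
noncomputable def obsPolyCons (Ω : Finset Face) {k : ℕ} (e : Fin k → OEdge) (a : OEdge) : ℤ[X] :=
  if ∃ j, e j = a then 0 else obsPoly Ω (Fin.cons a e : Fin (k + 1) → OEdge)

section Local

variable {Ω : Finset Face} {k : ℕ}

lemma arcSign_mul_self {e : Fin k → OEdge} (X : Finset (Sym2 Face)) (c : OEdge) :
    arcSign e X c * arcSign e X c = 1 := by
  rw [arcSign, mul_mul_mul_comm, spin_mul_self, ← Finset.prod_mul_distrib, one_mul]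
  refine Finset.prod_eq_one fun i _ => ?_
  split_ifs
  · rfl
  · exact sgn_mul_self _ _

lemma arcSign_succAbove {e : Fin (k + 1) → OEdge} (j : Fin (k + 1)) (X : Finset (Sym2 Face))
    (c : OEdge) : arcSign e X c
      = (if e j = c then 1 else sgn c (e j)) * arcSign (e ∘ j.succAbove) X c := by
  simp only [arcSign, Fin.prod_univ_succAbove _ j, Function.comp_apply]
  ring

/-- The contribution of the edge `c` to the local relation for `a`. -/
noncomputable def localTerm (e : Fin k → OEdge) (a c : OEdge) (X : Finset (Sym2 Face)) : ℤ :=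
  if edge c ∈ X then sgn a c * sgn c (rev c) * arcSign e X c
  else if ∃ j, e j = c then sgn a c * arcSign e X c else 0

lemma edge_ne_of_ne {e : Fin k → OEdge} (he : Function.Injective fun j => edge (e j))
    {i j : Fin k} (h : i ≠ j) : edge (e i) ≠ edge (e j) := fun h' => h (he h')

lemma injective_of_edge {e : Fin k → OEdge} (he : Function.Injective fun j => edge (e j)) :
    Function.Injective e := fun _ _ h => he (congrArg edge h)

lemma rev_ne_mark {e : Fin k → OEdge} (he : Function.Injective fun j => edge (e j)) (i j : Fin k) :
    e i ≠ rev (e j) := by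
  intro h
  have : i = j := he (by simp [h])
  subst this
  exact rev_ne _ h.symm

lemma sum_cons_rev {e : Fin k → OEdge} (hΩ : ∀ j, head (e j) ∈ Ω) {c : OEdge}
    (hv : head c ∈ Ω) (hc : ∀ j, edge (e j) ≠ edge c) (f : Finset (Sym2 Face) → ℤ[X]) :
    ∑ ω ∈ configs Ω (Fin.cons (rev c) e : Fin (k + 1) → OEdge), f (insert (edge c) ω)
      = ∑ Y ∈ (oddConfigs Ω e (head c)).filter fun Y => edge c ∈ Y, f Y := by
  have hmem : ∀ ω ∈ configs Ω (Fin.cons (rev c) e : Fin (k + 1) → OEdge), edge c ∉ ω := by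
    intro ω hω
    have := (mem_configs.1 hω).2.2.1 0
    simpa using this
  refine Finset.sum_bij' (fun ω _ => insert (edge c) ω) (fun Y _ => Y.erase (edge c))
    ?_ ?_ ?_ ?_ ?_
  · intro ω hω
    refine Finset.mem_filter.2 ⟨mem_oddConfigs_of_erase hc hv (Finset.mem_insert_self _ _) ?_,
      Finset.mem_insert_self _ _⟩
    rwa [Finset.erase_insert (hmem ω hω)]
  · intro Y hY
    exact erase_mem_configs_cons_rev hΩ (Finset.mem_filter.1 hY).2 (Finset.mem_filter.1 hY).1
  · intro ω hω
    exact Finset.erase_insert (hmem ω hω)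
  · intro Y hY
    exact Finset.insert_erase (Finset.mem_filter.1 hY).2
  · intro ω _
    rfl

/-- Inserting the edge of `c` is a bijection from the configurations with the mark `rev c` to the
odd ones that contain this edge, and the factor `X` counts it. If `rev c` is already a mark, both
sides vanish, since odd configurations avoid marked edges. -/
lemma localTerm_of_notMark {e : Fin k → OEdge} (he : Function.Injective fun j => edge (e j))
    (hΩ : ∀ j, head (e j) ∈ Ω) (a : OEdge) {c : OEdge} (hv : head c ∈ Ω) (hc : ∀ j, e j ≠ c) :
    C (sgn a c * sgn c (rev c)) * X * obsPolyCons Ω e (rev c)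
      = ∑ Y ∈ oddConfigs Ω e (head c), C (weight e Y * localTerm e a c Y) * X ^ Y.card := by
  by_cases hr : ∃ j, e j = rev c
  · rw [obsPolyCons, if_pos hr, mul_zero]
    obtain ⟨j, hj⟩ := hr
    refine (Finset.sum_eq_zero fun Y hY => ?_).symm
    have h1 : edge c ∉ Y := by
      have := (mem_oddConfigs.1 hY).2.1 j
      rwa [hj, edge_rev] at this
    rw [localTerm, if_neg h1, if_neg (by simpa using hc)]
    simp
  · have hr' : ∀ j, e j ≠ rev c := by simpa using hr
    have hce : ∀ j, edge (e j) ≠ edge c := by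
      intro j h
      rcases edge_eq_iff.1 h with h | h
      · exact hc j h
      · exact hr' j h
    rw [obsPolyCons, if_neg hr, obsPoly]
    have h2 : ∀ ω ∈ configs Ω (Fin.cons (rev c) e : Fin (k + 1) → OEdge),
        C (sgn a c * sgn c (rev c)) * X * (C (weight (Fin.cons (rev c) e : Fin (k + 1) → OEdge) ω)
          * X ^ ω.card) = C (weight e (insert (edge c) ω) * localTerm e a c (insert (edge c) ω)) *
            X ^ (insert (edge c) ω).card := by
      intro ω hω
      have hcω : edge c ∉ ω := by simpa using (mem_configs.1 hω).2.2.1 0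
      have h3 := arcSign_erase_mul_weight (e := e) (b := rev c) (X := insert (edge c) ω)
        (by simp) (by simpa using hce)
      rw [edge_rev, Finset.erase_insert hcω, rev_rev] at h3
      rw [weight_cons (injective_of_edge he) hr', h3, localTerm, if_pos (Finset.mem_insert_self _ _),
        Finset.card_insert_of_notMem hcω, pow_succ]
      simp only [C_mul]
      ring
    rw [Finset.mul_sum, Finset.sum_congr rfl h2, sum_cons_rev hΩ hv hce
      fun Y => C (weight e Y * localTerm e a c Y) * X ^ Y.card, Finset.sum_filter]
    refine Finset.sum_congr rfl fun Y _ => ?_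
    split_ifs with h
    · rfl
    · simp [localTerm, h, hc]

/-- The two half-edges `e j` and `rev (e j)` together affect every parity as the full edge does. -/
lemma erase_mem_configs_iff {e : Fin (k + 1) → OEdge} (hΩ : ∀ j, head (e j) ∈ Ω)
    {j : Fin (k + 1)} (he : ∀ i, edge (e (j.succAbove i)) ≠ edge (e j)) {Y : Finset (Sym2 Face)}
    (hY : edge (e j) ∈ Y) :
    Y.erase (edge (e j)) ∈ configs Ω (Fin.cons (rev (e j)) e : Fin (k + 2) → OEdge)
      ↔ Y ∈ configs Ω (e ∘ j.succAbove) := by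
  have hdeg : ∀ p, degree (Y.erase (edge (e j))) p
      + marks (Fin.cons (rev (e j)) e : Fin (k + 2) → OEdge) p
      = degree Y p + marks (e ∘ j.succAbove) p := by
    intro p
    have hne : tail (e j) ≠ head (e j) := by simp [tail, head, step_ne_zero]
    rw [← degree_erase hY p, marks_cons, marks_succAbove e j, head_rev]
    simp only [mem_edge_iff]
    by_cases h1 : tail (e j) = p <;> by_cases h2 : head (e j) = p <;> simp only [h1, h2] <;>
      first | (exact absurd (h1.trans h2.symm) hne) | (simp; try ring)
  simp only [mem_configs, hdeg, Fin.forall_fin_succ (n := k + 1), Fin.cons_zero, Fin.cons_succ, head_rev, edge_rev,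
    Finset.mem_erase, Function.comp_apply]
  constructor
  · rintro ⟨h1, h2, h3, h4⟩
    refine ⟨fun b hb => ?_, fun i => hΩ _, fun i h => h3.2 _ ⟨he i, h⟩, h4⟩
    by_cases h : b = edge (e j)
    · rw [h]; exact mem_dualEdges.2 ⟨h2.1, hΩ j⟩
    · exact h1 (Finset.mem_erase.2 ⟨h, hb⟩)
  · rintro ⟨h1, h2, h3, h4⟩
    refine ⟨(Finset.erase_subset _ _).trans h1, ⟨(mem_dualEdges.1 (h1 hY)).1, hΩ⟩, ⟨by simp, ?_⟩, h4⟩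
    rw [Fin.forall_iff_succAbove j]
    exact ⟨by simp, fun i h => h3 i h.2⟩

/-- A full edge `c` and its two halves occur with opposite signs: the configurations with the extra
mark `rev c` cancel those that lack the mark `c` but contain its full edge. What survives are the
configurations without the mark `c` and without its edge; these are the odd ones at `head c`. -/
lemma localTerm_of_mark {e : Fin (k + 1) → OEdge} (he : Function.Injective fun j => edge (e j))
    (hΩ : ∀ j, head (e j) ∈ Ω) (a : OEdge) (j : Fin (k + 1)) :
    C (sgn a (e j) * sgn (e j) (rev (e j))) * X * obsPolyCons Ω e (rev (e j))
        + C (sgn a (e j) * (-1) ^ (j : ℕ)) * obsPoly Ω (e ∘ j.succAbove)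
      = ∑ Y ∈ oddConfigs Ω e (head (e j)),
          C (weight e Y * localTerm e a (e j) Y) * X ^ Y.card := by
  set c := e j with hc
  set e' := e ∘ j.succAbove with he'
  have hinj := injective_of_edge he
  have hr' : ∀ i, e i ≠ rev c := fun i => rev_ne_mark he i j
  have hce : ∀ i, edge (e' i) ≠ edge c := fun i => edge_ne_of_ne he (Fin.succAbove_ne j i)
  have hr'' : ∀ i, e' i ≠ rev c := fun i => hr' _
  have hmem : ∀ ω, ω ∈ configs Ω e' ∧ edge c ∉ ω ↔ ω ∈ oddConfigs Ω e (head c) := by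
    intro ω
    simp only [mem_configs, mem_oddConfigs, Fin.forall_iff_succAbove j (P := fun i => edge (e i) ∉ ω),
      marks_succAbove e j]
    have h1 : ∀ p, ((Even (degree ω p + (marks e' p + if head c = p then 1 else 0)) ↔ p ≠ head c) ↔
        Even (degree ω p + marks e' p)) := by
      intro p
      by_cases h : head c = p
      · simp [h, ← add_assoc, Nat.even_add_one]
      · simp [h, Ne.symm h]
    simp only [← hc, ← he', h1]
    have h2 : ∀ i, head (e' i) ∈ Ω := fun i => hΩ _
    have h3 : ∀ i, e (j.succAbove i) = e' i := fun i => rfl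
    simp only [h3]
    tauto
  have hw : ∀ ω, (-1) ^ (j : ℕ) * weight e' ω = arcSign e' ω c * weight e ω := by
    intro ω
    rw [weight_succAbove hinj ω j]
    linear_combination -(-1) ^ (j : ℕ) * weight e' ω * arcSign_mul_self (e := e') ω c
  have hcancel : C (sgn a c * sgn c (rev c)) * X * obsPolyCons Ω e (rev c)
      + ∑ ω ∈ (configs Ω e').filter (fun ω => edge c ∈ ω),
        C (sgn a c * (-1) ^ (j : ℕ)) * (C (weight e' ω) * X ^ ω.card) = 0 := by
    rw [obsPolyCons, if_neg (by simpa using hr'), obsPoly, Finset.mul_sum]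
    have hb : ∑ ω ∈ configs Ω (Fin.cons (rev c) e : Fin (k + 2) → OEdge),
        C (sgn a c * sgn c (rev c)) * X *
          (C (weight (Fin.cons (rev c) e : Fin (k + 2) → OEdge) ω) * X ^ ω.card)
        = ∑ ω ∈ (configs Ω e').filter (fun ω => edge c ∈ ω),
          -(C (sgn a c * (-1) ^ (j : ℕ)) * (C (weight e' ω) * X ^ ω.card)) := by
      refine Finset.sum_bij' (fun ω _ => insert (edge c) ω) (fun Y _ => Y.erase (edge c))
        ?_ ?_ ?_ ?_ ?_
      · intro ω hω
        have hcω : edge c ∉ ω := by simpa using (mem_configs.1 hω).2.2.1 0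
        refine Finset.mem_filter.2 ⟨?_, Finset.mem_insert_self _ _⟩
        refine (erase_mem_configs_iff hΩ hce (Finset.mem_insert_self _ _)).1 ?_
        rwa [Finset.erase_insert hcω]
      · intro Y hY
        obtain ⟨hY, hcY⟩ := Finset.mem_filter.1 hY
        exact (erase_mem_configs_iff hΩ hce hcY).2 hY
      · intro ω hω
        have hcω : edge c ∉ ω := by simpa using (mem_configs.1 hω).2.2.1 0
        exact Finset.erase_insert hcω
      · intro Y hY
        exact Finset.insert_erase (Finset.mem_filter.1 hY).2
      · intro ω hω
        have hcω : edge c ∉ ω := by simpa using (mem_configs.1 hω).2.2.1 0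
        have h3 := arcSign_erase_mul_weight (e := e') (b := c) (X := insert (edge c) ω)
          (by simp) (by simpa using hce)
        rw [Finset.erase_insert hcω] at h3
        have h4 : arcSign e' (insert (edge c) ω) (rev c) = arcSign e' ω (rev c) := by
          have h5 := spin_erase_self (a := rev c) (X := insert (edge c) ω) (by simp)
          rw [edge_rev, Finset.erase_insert hcω] at h5
          rw [arcSign, arcSign, h5]
        -- The minus sign that produces the cancellation is the one in `sgn (rev c) c = -sgn c (rev
        -- c)`.
        have h6 : weight (Fin.cons (rev c) e : Fin (k + 2) → OEdge) ω
            = -(sgn c (rev c) * (-1) ^ (j : ℕ) * weight e' (insert (edge c) ω)) := by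
          rw [weight_cons hinj hr', weight_succAbove hinj ω j, arcSign_succAbove j,
            if_neg (hr' j), ← hc, ← he', sgn_swap (rev_ne c).symm]
          rw [h4] at h3
          linear_combination -sgn c (rev c) * arcSign e' ω (rev c) * (-1) ^ (j : ℕ) * h3
            - sgn c (rev c) * (-1) ^ (j : ℕ) * weight e' (insert (edge c) ω) *
              arcSign_mul_self (e := e') ω (rev c)
        rw [h6, Finset.card_insert_of_notMem hcω, pow_succ]
        have h7 : sgn c (rev c) * sgn c (rev c) = 1 := sgn_mul_self _ _
        have h8 : (C (sgn c (rev c)) * C (sgn c (rev c)) : ℤ[X]) = 1 := by rw [← C_mul, h7, C_1]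
        simp only [C_mul, C_neg]
        linear_combination -(C (sgn a c) * X * C ((-1) ^ (j : ℕ)) *
          C (weight e' (insert (edge c) ω)) * X ^ ω.card) * h8
    rw [hb, Finset.sum_neg_distrib, neg_add_cancel]
  rw [obsPoly, Finset.mul_sum, ← Finset.sum_filter_add_sum_filter_not _ (fun ω => edge c ∈ ω),
    ← add_assoc, hcancel, zero_add]
  refine Finset.sum_congr (by ext ω; simp [← hmem]) fun ω hω => ?_
  have hcω : edge c ∉ ω := ((hmem ω).2 hω).2
  rw [localTerm, if_neg hcω, if_pos ⟨j, rfl⟩, arcSign_succAbove j, if_pos rfl, ← mul_assoc, ← C_mul,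
    one_mul]
  congr 2
  linear_combination sgn a c * hw ω

/-- The sign of the relative position of `inc v d` and `inc v d'`. -/
def dirSgn (d d' : Dir) : ℤ := if d.val < d'.val then 1 else -1

lemma sgn_inc (v : Face) (d d' : Dir) : sgn (inc v d) (inc v d') = dirSgn d d' := by
  simp only [sgn, Prec, head_inc, inc_snd, lt_irrefl, false_or, true_and, and_false, dirSgn]
  revert d d'; decide

/-- The sign of the relative position of `inc v d` and its reversal. -/
def revSgn (d : Dir) : ℤ := if d = 0 ∨ d = 1 then -1 else 1

lemma sgn_inc_rev (v : Face) (d : Dir) : sgn (inc v d) (rev (inc v d)) = revSgn d := by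
  obtain ⟨x, y⟩ := v
  rcases dir_cases d with rfl | rfl | rfl | rfl <;>
    simp [sgn, Prec, inc, rev, head, dir_facts, revSgn]

set_option synthInstance.maxSize 1000 in
set_option synthInstance.maxHeartbeats 200000 in
-- Each of the four directions is empty, a wall or a mark, and an odd number are occupied. If `a` is
-- occupied, none or two others are, and their terms cancel; if `a` is free, one or three others
-- are, and their terms add up to the single sign on the left. The cases are checked exhaustively.
lemma local_identity (x m : Dir → Bool) (h : ∀ d, (x d && m d) = false)
    (hodd : ¬ Even (∑ d, (x d).toNat + ∑ d, (m d).toNat)) (a : Dir) :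
    (if x a || m a then 0 else
      (-1 : ℤ) ^ locExp (fun d => (x d).toNat) (fun d => (m d).toNat) a)
      = ∑ d, if d = a then 0 else (if x d then dirSgn a d * revSgn d else
        if m d then dirSgn a d else 0) *
          (-1 : ℤ) ^ locExp (fun d => (x d).toNat) (fun d => (m d).toNat) d := by
  simp only [sum_dir, locExp] at *
  have h0 := h 0
  have h1 := h 1
  have h2 := h 2
  have h3 := h 3
  clear h
  rcases dir_cases a with rfl | rfl | rfl | rfl
  all_goals
    simp only [dir_facts, if_true, if_false]
    generalize x 0 = x0 at *
    generalize x 1 = x1 at *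
    generalize x 2 = x2 at *
    generalize x 3 = x3 at *
    generalize m 0 = m0 at *
    generalize m 1 = m1 at *
    generalize m 2 = m2 at *
    generalize m 3 = m3 at *
    revert x0 x1 x2 x3 m0 m1 m2 m3
    decide

lemma localTerm_sum_eq {e : Fin k → OEdge} (he : Function.Injective fun j => edge (e j))
    (hΩ : ∀ j, head (e j) ∈ Ω) {a : OEdge} (ha : head a ∈ Ω) {Y : Finset (Sym2 Face)}
    (hY : Y ∈ oddConfigs Ω e (head a)) :
    (if edge a ∈ Y ∨ ∃ j, e j = a then 0 else arcSign e Y a)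
      = ∑ d, if d = a.2 then 0 else localTerm e a (inc (head a) d) Y := by
  obtain ⟨h1, h2, h3⟩ := mem_oddConfigs.1 hY
  set v := head a with hv
  have hpar : ∀ p ≠ v, Even (degree Y p + marks e p) := by
    intro p hp
    by_cases hpΩ : p ∈ Ω
    · exact (h3 p hpΩ).2 hp
    · simp [degree_of_notMem h1 hpΩ, marks_of_notMem hΩ hpΩ]
  obtain ⟨B, -, hB⟩ := exists_arcSign_eq h1 (injective_of_edge he) hΩ hpar
  have hodd : ¬ Even (degree Y v + marks e v) := fun h => (h3 v ha).1 h rfl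
  rw [degree_eq h1, marks_eq (injective_of_edge he), sum_dir, sum_dir] at hodd
  have hdisj : ∀ d, ¬ (edge (inc v d) ∈ Y ∧ ∃ j, e j = inc v d) := by
    rintro d ⟨h, j, hj⟩
    exact h2 j (by rwa [hj])
  have hx : ∀ d, edgeInd Y v d = (decide (edge (inc v d) ∈ Y)).toNat := by
    intro d; unfold edgeInd; split_ifs with h <;> simp [h]
  have hm : ∀ d, markInd e v d = (decide (∃ j, e j = inc v d)).toNat := by
    intro d; unfold markInd; split_ifs with h <;> simp only [h, decide_true, decide_false] <;> rfl
  have key := local_identity (fun d => decide (edge (inc v d) ∈ Y))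
    (fun d => decide (∃ j, e j = inc v d)) (fun d => by simpa using hdisj d)
    (by simpa only [hx, hm, sum_dir] using hodd) a.2
  have hloc : locExp (fun d => (decide (edge (inc v d) ∈ Y)).toNat)
      (fun d => (decide (∃ j, e j = inc v d)).toNat) = locExp (edgeInd Y v) (markInd e v) := by
    rw [funext hx, funext hm]
  rw [hloc] at key
  have hterm : ∀ d, localTerm e a (inc v d) Y
      = B * ((if decide (edge (inc v d) ∈ Y) then dirSgn a.2 d * revSgn d else
        if decide (∃ j, e j = inc v d) then dirSgn a.2 d else 0) *
          (-1 : ℤ) ^ locExp (edgeInd Y v) (markInd e v) d) := by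
    intro d
    have ha' : sgn a (inc v d) = dirSgn a.2 d := by rw [← sgn_inc v, inc_head]
    simp only [localTerm, hB, ha', sgn_inc_rev, decide_eq_true_eq]
    split_ifs <;> ring
  have ha' : arcSign e Y a = B * (-1) ^ locExp (edgeInd Y v) (markInd e v) a.2 := by
    rw [← hB, inc_head]
  simp only [hterm, ha']
  simp only [hv, inc_head, Bool.or_eq_true, decide_eq_true_eq] at key ⊢
  have key' := congrArg (B * ·) key
  simp only [Finset.mul_sum, mul_ite, mul_zero] at key' ⊢
  exact key'

/-- The local relation between the values at `a` and at the edges that follow `a`. -/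
theorem obsPolyCons_eq {e : Fin (k + 1) → OEdge} (he : Function.Injective fun j => edge (e j))
    (hΩ : ∀ j, head (e j) ∈ Ω) {a : OEdge} (ha : head a ∈ Ω) :
    obsPolyCons Ω e a
      = (∑ d, if d = a.2 then 0 else
          C (sgn a (inc (head a) d) * sgn (inc (head a) d) (rev (inc (head a) d))) * X *
            obsPolyCons Ω e (rev (inc (head a) d)))
        + ∑ j, if head (e j) = head a ∧ e j ≠ a then
          C (sgn a (e j) * (-1) ^ (j : ℕ)) * obsPoly Ω (e ∘ j.succAbove) else 0 := by
  have hinj := injective_of_edge he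
  have hterm : ∀ d, C (sgn a (inc (head a) d) * sgn (inc (head a) d) (rev (inc (head a) d))) * X *
      obsPolyCons Ω e (rev (inc (head a) d))
      + (∑ j, if e j = inc (head a) d then
          C (sgn a (e j) * (-1) ^ (j : ℕ)) * obsPoly Ω (e ∘ j.succAbove) else 0)
      = ∑ Y ∈ oddConfigs Ω e (head a),
          C (weight e Y * localTerm e a (inc (head a) d) Y) * X ^ Y.card := by
    intro d
    by_cases h : ∃ j, e j = inc (head a) d
    · obtain ⟨j, hj⟩ := h
      have := localTerm_of_mark he hΩ a j
      rw [hj, head_inc] at this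
      rw [← this]
      congr 1
      rw [Finset.sum_eq_single j, if_pos hj, hj]
      · intro i _ hi
        rw [if_neg]
        intro h
        exact hi (hinj (h.trans hj.symm))
      · simp
    · push Not at h
      have := localTerm_of_notMark he hΩ a (c := inc (head a) d) (by simpa using ha) h
      rw [head_inc] at this
      rw [← this]
      simp only [h, if_false, Finset.sum_const_zero, add_zero]
  -- A mark pointing to `head a` arrives there in exactly one direction; the direction `a.2` would
  -- be `a` itself and is left out on both sides.
  have hsum : ∑ j, (if head (e j) = head a ∧ e j ≠ a then
      C (sgn a (e j) * (-1) ^ (j : ℕ)) * obsPoly Ω (e ∘ j.succAbove) else 0)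
      = ∑ d, if d = a.2 then 0 else ∑ j, if e j = inc (head a) d then
          C (sgn a (e j) * (-1) ^ (j : ℕ)) * obsPoly Ω (e ∘ j.succAbove) else 0 := by
    have : ∀ d, (if d = a.2 then 0 else ∑ j, if e j = inc (head a) d then
          C (sgn a (e j) * (-1) ^ (j : ℕ)) * obsPoly Ω (e ∘ j.succAbove) else 0)
        = ∑ j, if d ≠ a.2 ∧ e j = inc (head a) d then
          C (sgn a (e j) * (-1) ^ (j : ℕ)) * obsPoly Ω (e ∘ j.succAbove) else 0 := by
      intro d
      by_cases h : d = a.2 <;> simp [h]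
    rw [Finset.sum_congr rfl fun d _ => this d, Finset.sum_comm]
    refine Finset.sum_congr rfl fun j _ => ?_
    rw [Finset.sum_eq_single (e j).2]
    · refine if_congr ?_ rfl rfl
      constructor
      · rintro ⟨h1, h2⟩
        exact ⟨fun h => h2 (by rw [eq_inc h1, h, inc_head]), eq_inc h1⟩
      · rintro ⟨h1, h2⟩
        exact ⟨by rw [h2, head_inc], fun h => h1 (by rw [h])⟩
    · intro d _ hd
      rw [if_neg]
      rintro ⟨-, h⟩
      exact hd (by rw [h, inc_snd])
    · simp
  rw [hsum, ← Finset.sum_add_distrib]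
  have hsplit : ∀ d, (if d = a.2 then 0 else
      C (sgn a (inc (head a) d) * sgn (inc (head a) d) (rev (inc (head a) d))) * X *
            obsPolyCons Ω e (rev (inc (head a) d)))
      + (if d = a.2 then 0 else ∑ j, if e j = inc (head a) d then
          C (sgn a (e j) * (-1) ^ (j : ℕ)) * obsPoly Ω (e ∘ j.succAbove) else 0)
      = ∑ Y ∈ oddConfigs Ω e (head a), C (weight e Y * (if d = a.2 then 0 else
          localTerm e a (inc (head a) d) Y)) * X ^ Y.card := by
    intro d
    split_ifs
    · simp
    · exact hterm d
  rw [Finset.sum_congr rfl fun d _ => hsplit d, Finset.sum_comm]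
  -- For a fixed odd configuration the sum over directions collapses to the term of `a`; the odd
  -- configurations that survive are those in which `a` can be added as a mark.
  have hY : ∀ Y ∈ oddConfigs Ω e (head a), ∑ d, C (weight e Y * (if d = a.2 then 0 else
      localTerm e a (inc (head a) d) Y)) * X ^ Y.card
      = C (weight e Y * (if edge a ∈ Y ∨ ∃ j, e j = a then 0 else arcSign e Y a)) * X ^ Y.card := by
    intro Y hY
    rw [localTerm_sum_eq he hΩ ha hY, ← Finset.sum_mul, Finset.mul_sum, map_sum]
  rw [Finset.sum_congr rfl hY, obsPolyCons]
  split_ifs with h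
  · simp [h]
  · simp only [h, or_false]
    rw [obsPoly, configs_cons hΩ ha, Finset.sum_filter]
    refine Finset.sum_congr rfl fun Y _ => ?_
    rw [weight_cons hinj (by simpa using h)]
    by_cases h1 : edge a ∈ Y
    · simp [h1]
    · simp [h1, mul_comm]

end Local

/-! ### The expansion of a multipoint observable -/

/-- The factor `X` makes every coefficient of a value a combination of coefficients of lower degree
of other values, and the constant coefficients vanish. -/
lemma eq_zero_of_local {ι : Type*} [Fintype ι] {H : OEdge → ℤ[X]}
    (h : ∀ a, ∃ (t : ι → ℤ) (b : ι → OEdge), H a = ∑ i, C (t i) * X * H (b i)) (a : OEdge) :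
    H a = 0 := by
  have key : ∀ n, ∀ a, (H a).coeff n = 0 := by
    intro n
    induction n with
    | zero =>
      intro a
      obtain ⟨t, b, hab⟩ := h a
      rw [hab]; simp [mul_assoc]
    | succ n ih =>
      intro a
      obtain ⟨t, b, hab⟩ := h a
      rw [hab]; simp [mul_assoc, coeff_X_mul, ih]
  exact Polynomial.ext fun n => by simp [key n a]

lemma obsPoly_eq_zero {Ω : Finset Face} {k : ℕ} {e : Fin k → OEdge} {j : Fin k}
    (hj : head (e j) ∉ Ω) : obsPoly Ω e = 0 := by
  rw [obsPoly, Finset.sum_eq_zero]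
  intro ω hω
  exact absurd ((mem_configs.1 hω).2.1 j) hj

lemma sum_local_relation {R ι κ : Type*} [CommRing R] [Fintype ι] [Fintype κ] (z : R) (t f : ι → R)
    (c s : κ → R) (g : κ → ι → R) :
    z * (∑ d, t d * f d + ∑ j, c j * s j) - ∑ j, c j * (∑ d, t d * g j d + s j * z)
      = ∑ d, t d * (z * f d - ∑ j, c j * g j d) := by
  simp only [mul_add, mul_sub, Finset.sum_add_distrib, Finset.sum_sub_distrib, Finset.mul_sum]
  rw [Finset.sum_comm (f := fun j d => c j * (t d * g j d))]
  have h1 : ∀ d, z * (t d * f d) = t d * (z * f d) := fun d => by ring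
  have h2 : ∀ d j, c j * (t d * g j d) = t d * (c j * g j d) := fun d j => by ring
  have h3 : ∀ j, z * (c j * s j) = c j * (s j * z) := fun j => by ring
  simp only [h1, h2, h3]
  ring

/-- Both sides obey the local relation in `a`. The two-point polynomial with the mark `e j` has the
source `±Z` there, so the sum on the right reproduces the sources of the left side. -/
theorem obsPoly_expansion {Ω : Finset Face} {k : ℕ} {e : Fin (k + 1) → OEdge}
    (he : Function.Injective fun j => edge (e j)) {a : OEdge} (ha : ∀ j, edge (e j) ≠ edge a) :
    obsPoly Ω (Fin.elim0 : Fin 0 → OEdge) * obsPoly Ω (Fin.cons a e : Fin (k + 2) → OEdge)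
      = ∑ j : Fin (k + 1), (-1) ^ (j : ℕ) *
          obsPoly Ω (Fin.cons a (fun _ => e j) : Fin 2 → OEdge) * obsPoly Ω (e ∘ j.succAbove) := by
  by_cases hΩ : ∀ j, head (e j) ∈ Ω
  · set Z := obsPoly Ω (Fin.elim0 : Fin 0 → OEdge) with hZ
    -- The difference has to be defined at every oriented edge, including the marks, where
    -- `obsPolyCons` is set to zero.
    set H : OEdge → ℤ[X] := fun a => Z * obsPolyCons Ω e a
      - ∑ j : Fin (k + 1), (-1) ^ (j : ℕ) * obsPoly Ω (e ∘ j.succAbove) *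
        obsPolyCons Ω (fun _ : Fin 1 => e j) a with hH
    have hH0 := eq_zero_of_local (H := H) (ι := Dir) (fun b => by
      by_cases hb : head b ∈ Ω
      · refine ⟨fun d => if d = b.2 then 0 else
          sgn b (inc (head b) d) * sgn (inc (head b) d) (rev (inc (head b) d)),
          fun d => rev (inc (head b) d), ?_⟩
        have h1 := obsPolyCons_eq he hΩ hb
        have h2 : ∀ j, obsPolyCons Ω (fun _ : Fin 1 => e j) b
            = (∑ d, if d = b.2 then 0 else
          C (sgn b (inc (head b) d) * sgn (inc (head b) d) (rev (inc (head b) d))) * X *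
            obsPolyCons Ω (fun _ : Fin 1 => e j) (rev (inc (head b) d)))
            + if head (e j) = head b ∧ e j ≠ b then C (sgn b (e j)) * Z else 0 := by
          intro j
          have h3 := obsPolyCons_eq (e := fun _ : Fin 1 => e j)
            (fun i j _ => Fin.ext (by omega)) (fun _ => hΩ j) hb
          have h4 : ((fun _ : Fin 1 => e j) ∘ (0 : Fin 1).succAbove) = (Fin.elim0 : Fin 0 → OEdge) :=
            Subsingleton.elim _ _
          rw [show ∀ f : Fin (0 + 1) → ℤ[X], ∑ j, f j = f 0 from Fin.sum_univ_one] at h3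
          simpa only [h4, Fin.val_zero, pow_zero, mul_one] using h3
        have h3 : ∀ j, (if head (e j) = head b ∧ e j ≠ b then
            C (sgn b (e j) * (-1) ^ (j : ℕ)) * obsPoly Ω (e ∘ j.succAbove) else 0)
            = ((-1) ^ (j : ℕ) * obsPoly Ω (e ∘ j.succAbove)) *
              (if head (e j) = head b ∧ e j ≠ b then C (sgn b (e j)) else 0) := by
          intro j
          split_ifs
          · simp only [C_mul, C_pow, C_neg, C_1]; ring
          · simp
        have h4 : ∀ j, (if head (e j) = head b ∧ e j ≠ b then C (sgn b (e j)) * Z else 0)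
            = (if head (e j) = head b ∧ e j ≠ b then C (sgn b (e j)) else 0) * Z := by
          intro j
          rw [ite_mul, zero_mul]
        have h5 : ∀ d (P : ℤ[X]), (if d = b.2 then 0 else
            C (sgn b (inc (head b) d) * sgn (inc (head b) d) (rev (inc (head b) d))) * X * P)
            = C (if d = b.2 then 0 else
              sgn b (inc (head b) d) * sgn (inc (head b) d) (rev (inc (head b) d))) * X * P := by
          intro d P
          split_ifs <;> simp
        simp only [h5, h3] at h1
        simp only [h5, h4] at h2
        simp only [hH]
        rw [h1, Finset.sum_congr rfl fun (j : Fin (k + 1)) _ =>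
          congrArg ((-1) ^ (j : ℕ) * obsPoly Ω (e ∘ j.succAbove) * ·) (h2 j)]
        exact sum_local_relation _ _ _ _ _ _
      -- No configuration has a mark pointing out of `Ω`, so every value at `b` is zero.
      · refine ⟨fun _ => 0, fun _ => b, ?_⟩
        have h1 : ∀ {l : ℕ} (e' : Fin l → OEdge), obsPolyCons Ω e' b = 0 := by
          intro l e'
          rw [obsPolyCons]
          split_ifs
          · rfl
          · exact obsPoly_eq_zero (j := 0) (by simpa using hb)
        simp [hH, h1]) a
    have h1 : ∀ j, e j ≠ a := fun j h => ha j (by rw [h])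
    simp only [hH, obsPolyCons, h1, exists_false, exists_const, if_false, sub_eq_zero] at hH0
    rw [hH0]
    exact Finset.sum_congr rfl fun j _ => by ring
  -- If some `e i` points out of `Ω`, each product contains a vanishing factor: the one in which `e
  -- i` is a mark.
  · push Not at hΩ
    obtain ⟨i, hi⟩ := hΩ
    rw [obsPoly_eq_zero (e := Fin.cons a e) (j := i.succ) (by simpa using hi), mul_zero,
      Finset.sum_eq_zero]
    intro j _
    by_cases hij : i = j
    · subst hij
      rw [obsPoly_eq_zero (e := Fin.cons a fun _ => e i) (j := 1) (by simpa using hi)]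
      ring
    · obtain ⟨l, hl⟩ := Fin.exists_succAbove_eq hij
      rw [obsPoly_eq_zero (e := e ∘ j.succAbove) (j := l) (by simpa [hl] using hi), mul_zero]

/-! ### Turns and signs at a single face -/

/-- The turn of a path in terms of the occupied directions at a face. -/
def turnB (b : Bool) (O : Dir → Bool) (d : Dir) : ℤ :=
  if O (d + 1) && O (d + 3) then if (b = true ↔ d = 1 ∨ d = 3) then 1 else -1
  else if O (d + 1) then 1 else if O (d + 3) then -1 else 0

/-- The direction in which a path that arrives in the direction `d` leaves a face. -/
def outDir (b : Bool) (O : Dir → Bool) (d : Dir) : Dir :=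
  d + ((turnB b O d : ℤ) : ZMod 4)

set_option maxRecDepth 100000 in
-- The linking of edges at a face is reversible, with opposite turns. It also survives the removal
-- of a linked pair: of four occupied edges the other two form a corner, and their turn no longer
-- needs the resolution.
lemma outDir_spec : ∀ (O : Dir → Bool) (b : Bool) (d : Dir), Even (∑ c, (O c).toNat) →
    O (d + 2) = true → O (outDir b O d) = true ∧ outDir b O d ≠ d + 2 ∧
      turnB b O (outDir b O d + 2) = -turnB b O d ∧ outDir b O (outDir b O d + 2) = d + 2 ∧
      ∀ x, (O (x + 2) && decide (x + 2 ≠ d + 2) && decide (x + 2 ≠ outDir b O d)) = true →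
      turnB b (fun c => O c && decide (c ≠ d + 2) && decide (c ≠ outDir b O d)) x
        = turnB b O x := by
  decide

set_option maxRecDepth 100000 in
set_option synthInstance.maxSize 1000 in
set_option synthInstance.maxHeartbeats 200000 in
-- Modulo `4` the outgoing direction is `d` plus the turn, so the defect of the representatives is
-- `-4`, `0` or `4`. As the fourth power of `zeta8` is `-1`, this defect is the sign by which the
-- factor of the mark changes.
lemma shorten_sign : ∀ (x m : Dir → Bool) (b : Bool) (d : Dir), (∀ c, (x c && m c) = false) →
    (x d || m d) = false → ¬ Even (∑ c, (x c).toNat + ∑ c, (m c).toNat) →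
    ∀ o, o = outDir b (fun c => x (c + 2) || m (c + 2) || decide (c = d + 2)) d →
    x (o + 2) = true →
    ∃ n : Fin 3, (o.val : ℤ) - d.val
      - turnB b (fun c => x (c + 2) || m (c + 2) || decide (c = d + 2)) d = 4 * (n.val - 1) ∧
      (-1 : ℤ) ^ locExp (fun c => (x c).toNat) (fun c => (m c).toNat) d
        = (-1) ^ (n.val + 1) * (-1) ^ locExp (fun c => (x c).toNat) (fun c => (m c).toNat) (o + 2) := by
  decide

set_option maxRecDepth 100000 in
set_option synthInstance.maxSize 1000 in
set_option synthInstance.maxHeartbeats 200000 in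
-- The path ends here along the reversal of the mark in direction `p`. The reversal shifts the
-- defect by `2`, hence by a factor `i` for each path.
lemma remove_sign : ∀ (x m : Dir → Bool) (b : Bool) (d p : Dir), (∀ c, (x c && m c) = false) →
    (x d || m d || x p || m p || decide (p = d)) = false →
    Even (∑ c, (x c).toNat + ∑ c, (m c).toNat) →
    outDir b (fun c => x (c + 2) || m (c + 2) || decide (c = d + 2) || decide (c = p + 2)) d = p + 2 →
    ∃ n : Fin 3, (p.val : ℤ) - d.val
      - turnB b (fun c => x (c + 2) || m (c + 2) || decide (c = d + 2) || decide (c = p + 2)) d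
        = 4 * (n.val - 1) + 2 ∧
      dirSgn d p * (-1 : ℤ) ^ locExp (fun c => (x c).toNat) (fun c => (m c).toNat) d
        * (-1) ^ locExp (fun c => (x c).toNat) (fun c => (m c).toNat) p = (-1) ^ (n.val + 1) := by
  decide

/-! ### Paths of a configuration -/

open Classical in
/-- The directions in which a path can leave the face `v`. -/
noncomputable def occ {k : ℕ} (e : Fin k → OEdge) (ω : Finset (Sym2 Face)) (v : Face) (d : Dir) :
    Bool := decide (Occupied e ω (v, d))

section Paths

variable {Ω : Finset Face} {k : ℕ}

lemma occ_iff {e : Fin k → OEdge} {ω : Finset (Sym2 Face)} {v : Face} {d : Dir} :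
    occ e ω v d = true ↔ Occupied e ω (v, d) := by
  simp [occ]

lemma turn_eq (ρ : Resolution) (e : Fin k → OEdge) (ω : Finset (Sym2 Face)) (a : OEdge) :
    turn ρ e ω a = turnB (ρ ω (head a)) (occ e ω (head a)) a.2 := by
  have h1 := occ_iff (e := e) (ω := ω) (v := head a) (d := a.2 + 1)
  have h2 := occ_iff (e := e) (ω := ω) (v := head a) (d := a.2 + 3)
  simp only [turn, turnB, ← h1, ← h2, Bool.and_eq_true]

lemma next_eq (ρ : Resolution) (e : Fin k → OEdge) (ω : Finset (Sym2 Face)) (a : OEdge) :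
    next ρ e ω a = (head a, outDir (ρ ω (head a)) (occ e ω (head a)) a.2) := by
  rw [next, turn_eq]; rfl

lemma dir_add_two_add_two (d : Dir) : d + 2 + 2 = d := by
  revert d; decide

lemma pair_eq_rev_inc (v : Face) (d : Dir) : (v, d) = rev (inc v (d + 2)) := by
  rw [rev_inc, dir_add_two_add_two]

lemma occupied_iff {e : Fin k → OEdge} {ω : Finset (Sym2 Face)} {a : OEdge} :
    Occupied e ω a ↔ edge a ∈ ω ∨ ∃ j, e j = rev a := by
  refine or_congr Iff.rfl (exists_congr fun j => ?_)
  constructor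
  · intro h; rw [h, rev_rev]
  · intro h; rw [EndsAt, h, rev_rev]

lemma occ_eq (e : Fin k → OEdge) (ω : Finset (Sym2 Face)) (v : Face) (d : Dir) :
    occ e ω v d = (decide (edge (inc v (d + 2)) ∈ ω) || decide (∃ j, e j = inc v (d + 2))) := by
  rw [Bool.eq_iff_iff, occ_iff]
  simp only [decide_eq_true_eq, Bool.or_eq_true]
  rw [pair_eq_rev_inc, occupied_iff, edge_rev, rev_rev]

lemma markInd_eq_toNat (e : Fin k → OEdge) (v : Face) (d : Dir) :
    markInd e v d = (decide (∃ j, e j = inc v d)).toNat := by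
  unfold markInd; split_ifs with h <;> simp only [h, decide_true, decide_false] <;> rfl

lemma edgeInd_eq_toNat (X : Finset (Sym2 Face)) (v : Face) (d : Dir) :
    edgeInd X v d = (decide (edge (inc v d) ∈ X)).toNat := by
  unfold edgeInd; split_ifs with h <;> simp [h]

lemma edge_mark_disjoint {e : Fin k → OEdge} {ω : Finset (Sym2 Face)} (h : ∀ j, edge (e j) ∉ ω)
    (v : Face) (d : Dir) :
    (decide (edge (inc v d) ∈ ω) && decide (∃ j, e j = inc v d)) = false := by
  rw [← Bool.not_eq_true]
  simp only [Bool.and_eq_true, decide_eq_true_eq]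
  rintro ⟨h1, j, hj⟩
  exact h j (by rwa [hj])

lemma even_occ {e : Fin k → OEdge} (he : Function.Injective fun j => edge (e j))
    {ω : Finset (Sym2 Face)} (hω : ω ∈ configs Ω e) (v : Face) :
    Even (∑ d, (occ e ω v d).toNat) := by
  have h1 := even_of_mem_configs hω v
  rw [degree_eq (mem_configs.1 hω).1, marks_eq (injective_of_edge he), ← Finset.sum_add_distrib] at h1
  have h2 : ∀ d, (occ e ω v d).toNat = edgeInd ω v (d + 2) + markInd e v (d + 2) := by
    intro d
    have h3 := edge_mark_disjoint (mem_configs.1 hω).2.2.1 v (d + 2)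
    rw [occ_eq, markInd_eq_toNat, edgeInd_eq_toNat]
    revert h3
    generalize decide (edge (inc v (d + 2)) ∈ ω) = x
    generalize decide (∃ j, e j = inc v (d + 2)) = y
    revert x y; decide
  rw [Finset.sum_congr rfl fun d _ => h2 d]
  have h3 := Equiv.sum_comp (Equiv.addRight (2 : Dir)) fun d => edgeInd ω v d + markInd e v d
  simp only [Equiv.coe_addRight] at h3
  rwa [h3]

/-- `a` runs along the last half-edge of a path. -/
def IsStop (e : Fin k → OEdge) (a : OEdge) : Prop := ∃ j, a = rev (e j)

/-- `Run N t S a c n T`: iterating `N` from `a` leads to `c` after `n` steps, never leaving a point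
of `S`, and the sum of `t` over the points that are left is `T`. -/
inductive Run {α : Type*} (N : α → α) (t : α → ℤ) (S : α → Prop) : α → α → ℕ → ℤ → Prop
  | nil (a : α) : Run N t S a a 0 0
  | cons {a c : α} {n : ℕ} {T : ℤ} : ¬ S a → Run N t S (N a) c n T → Run N t S a c (n + 1) (t a + T)

lemma Run.snoc {α : Type*} {N : α → α} {t : α → ℤ} {S : α → Prop} {a c : α} {n : ℕ} {T : ℤ}
    (h : Run N t S a c n T) (hc : ¬ S c) : Run N t S a (N c) (n + 1) (T + t c) := by
  induction h with
  | nil a => simpa [add_comm] using Run.cons hc (Run.nil (N a))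
  | cons ha _ ih => rw [add_assoc (t _)]; exact Run.cons ha (ih hc)

lemma Run.iterate {α : Type*} {N : α → α} {t : α → ℤ} {S : α → Prop} {a c : α} {n : ℕ} {T : ℤ}
    (h : Run N t S a c n T) :
    N^[n] a = c ∧ (∀ i < n, ¬ S (N^[i] a)) ∧ ∑ i ∈ Finset.range n, t (N^[i] a) = T := by
  induction h with
  | nil a => simp
  | cons ha _ ih =>
    obtain ⟨h1, h2, h3⟩ := ih
    refine ⟨by rwa [Function.iterate_succ_apply], fun i hi => ?_, ?_⟩
    · cases i with
      | zero => exact ha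
      | succ i => rw [Function.iterate_succ_apply]; exact h2 i (by omega)
    · rw [Finset.sum_range_succ']
      simp only [Function.iterate_succ_apply, Function.iterate_zero_apply]
      rw [h3, add_comm]

lemma next_spec {r : Face → Bool} {e : Fin k → OEdge} {ω : Finset (Sym2 Face)}
    (he : Function.Injective fun j => edge (e j)) (hω : ω ∈ configs Ω e) {a : OEdge}
    (ha : Occupied e ω (rev a)) :
    Occupied e ω (next (fun _ => r) e ω a) ∧ next (fun _ => r) e ω a ≠ rev a ∧
      tail (next (fun _ => r) e ω a) = head a ∧
      turn (fun _ => r) e ω (rev (next (fun _ => r) e ω a)) = -turn (fun _ => r) e ω a ∧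
      next (fun _ => r) e ω (rev (next (fun _ => r) e ω a)) = rev a := by
  have h0 : occ e ω (head a) (a.2 + 2) = true :=
    occ_iff.2 ha
  obtain ⟨h1, h2, h3, h4, -⟩ := outDir_spec (occ e ω (head a)) (r (head a)) a.2
    (even_occ he hω _) h0
  have hn := next_eq (fun _ => r) e ω a
  have hr : head (rev (next (fun _ => r) e ω a)) = head a := by rw [head_rev, hn]; rfl
  have hr2 : (rev (next (fun _ => r) e ω a)).2
      = outDir (r (head a)) (occ e ω (head a)) a.2 + 2 := by rw [rev_snd, hn]
  refine ⟨?_, ?_, by rw [hn]; rfl, ?_, ?_⟩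
  · rw [hn]
    exact occ_iff.1 h1
  · rw [hn]
    exact fun h => h2 (congrArg Prod.snd h)
  · rw [turn_eq, turn_eq, hr, hr2]
    exact h3
  · rw [next_eq, hr, hr2]
    exact congrArg (Prod.mk (head a)) h4

/-- Removing the linked pair `rev a`, `next a` of occupied edges at a face does not change the other
turns. -/
lemma turn_congr {r : Face → Bool} {e : Fin k → OEdge} {ω : Finset (Sym2 Face)}
    (he : Function.Injective fun j => edge (e j)) (hω : ω ∈ configs Ω e) {a : OEdge}
    (ha : Occupied e ω (rev a)) {l : ℕ} {e' : Fin l → OEdge} {ω' : Finset (Sym2 Face)}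
    (hO : ∀ x, Occupied e' ω' x ↔ Occupied e ω x ∧ x ≠ rev a ∧ x ≠ next (fun _ => r) e ω a)
    {x : OEdge} (hx : Occupied e' ω' (rev x)) :
    turn (fun _ => r) e' ω' x = turn (fun _ => r) e ω x := by
  have hn := next_eq (fun _ => r) e ω a
  rw [turn_eq, turn_eq]
  by_cases hv : head x = head a
  · have h0 : occ e ω (head a) (a.2 + 2) = true :=
      occ_iff.2 ha
    obtain ⟨-, -, -, -, h5⟩ := outDir_spec (occ e ω (head a)) (r (head a)) a.2
      (even_occ he hω _) h0
    have hocc : occ e' ω' (head a) = fun c => occ e ω (head a) c && decide (c ≠ a.2 + 2) &&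
        decide (c ≠ outDir (r (head a)) (occ e ω (head a)) a.2) := by
      funext c
      rw [Bool.eq_iff_iff]
      simp only [decide_eq_true_eq, hO, hn, Bool.and_eq_true, occ_iff, and_assoc]
      refine and_congr Iff.rfl (and_congr (not_congr ?_) (not_congr ?_))
      · simp [rev]
      · simp
    have h6 := h5 x.2 (by
      rw [← congrFun hocc (x.2 + 2), occ_iff, ← hv]
      exact hx)
    rw [hv, hocc]
    exact h6
  · have hocc : occ e' ω' (head x) = occ e ω (head x) := by
      funext c
      rw [Bool.eq_iff_iff]
      simp only [occ_iff, hO, hn, and_iff_left_iff_imp]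
      intro _
      exact ⟨fun h => hv (congrArg Prod.fst h), fun h => hv (congrArg Prod.fst h)⟩
    rw [hocc]

/-- By `hO` the smaller configuration arises by deleting one linked pair, which leaves all its turns
unchanged (`turn_congr`), and by `hS` no run stops earlier in the larger one. The condition on `x`
is needed only if the run moves at all. -/
lemma run_lift {r : Face → Bool} {e : Fin k → OEdge} {ω : Finset (Sym2 Face)}
    (he : Function.Injective fun j => edge (e j)) (hω : ω ∈ configs Ω e) {a : OEdge}
    (ha : Occupied e ω (rev a)) {l : ℕ} {e' : Fin l → OEdge} {ω' : Finset (Sym2 Face)}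
    (he' : Function.Injective fun j => edge (e' j)) (hω' : ω' ∈ configs Ω e')
    (hO : ∀ x, Occupied e' ω' x ↔ Occupied e ω x ∧ x ≠ rev a ∧ x ≠ next (fun _ => r) e ω a)
    (hS : ∀ x, Occupied e' ω' x → ¬ IsStop e' x → ¬ IsStop e x) {x c : OEdge} {n : ℕ} {T : ℤ}
    (h : Run (next (fun _ => r) e' ω') (turn (fun _ => r) e' ω') (IsStop e') x c n T)
    (hx : ¬ IsStop e' x → Occupied e' ω' (rev x) ∧ ¬ IsStop e x) :
    Run (next (fun _ => r) e ω) (turn (fun _ => r) e ω) (IsStop e) x c n T := by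
  induction h with
  | nil x => exact Run.nil x
  | @cons x c n T hxs _ ih =>
    obtain ⟨h1, h2⟩ := hx hxs
    have h3 := turn_congr he hω ha hO h1
    have h4 : next (fun _ => r) e' ω' x = next (fun _ => r) e ω x := by rw [next, next, h3]
    have h5 := (next_spec (r := r) he' hω' h1).1
    have h6 := ih fun h => ⟨?_, hS _ h5 h⟩
    · rw [h3]
      rw [h4] at h6
      exact Run.cons h2 h6
    · rcases h5 with h5 | h5
      · exact Or.inl (by rwa [edge_rev])
      · exact absurd h5 h

end Paths

/-! ### Pairings and their phases -/

section Pairings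

variable {k : ℕ}

/-- The pairs `(s, μ s)` with `s < μ s`. -/
def pairsOf (μ : Fin k → Fin k) : Finset (Fin k × Fin k) :=
  Finset.univ.filter fun q => q.1 < q.2 ∧ q.2 = μ q.1

lemma mem_pairsOf {μ : Fin k → Fin k} {q : Fin k × Fin k} :
    q ∈ pairsOf μ ↔ q.1 < q.2 ∧ q.2 = μ q.1 := by
  simp [pairsOf]

lemma prod_pairsOf {M : Type*} [CommMonoid M] {μ : Fin k → Fin k} (h1 : ∀ s, μ (μ s) = s)
    (h2 : ∀ s, μ s ≠ s) (f : Fin k → M) :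
    ∏ q ∈ pairsOf μ, f q.1 * f q.2 = ∏ i, f i := by
  rw [← Finset.prod_filter_mul_prod_filter_not Finset.univ (fun i => i < μ i) f,
    Finset.prod_mul_distrib]
  congr 1
  · refine Finset.prod_bij' (fun q _ => q.1) (fun i _ => (i, μ i)) ?_ ?_ ?_ ?_ ?_
    · intro q hq
      obtain ⟨h3, h4⟩ := mem_pairsOf.1 hq
      simpa [← h4] using h3
    · intro i hi
      exact mem_pairsOf.2 ⟨(Finset.mem_filter.1 hi).2, rfl⟩
    · intro q hq
      exact Prod.ext rfl (mem_pairsOf.1 hq).2.symm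
    · intro i _; rfl
    · intro q _; rfl
  · refine Finset.prod_bij' (fun q _ => q.2) (fun i _ => (μ i, i)) ?_ ?_ ?_ ?_ ?_
    · intro q hq
      obtain ⟨h3, h4⟩ := mem_pairsOf.1 hq
      have h5 : μ q.2 = q.1 := by rw [h4, h1]
      exact Finset.mem_filter.2 ⟨Finset.mem_univ _, by rw [h5]; exact h3.not_gt⟩
    · intro i hi
      have := (Finset.mem_filter.1 hi).2
      exact mem_pairsOf.2 ⟨lt_of_le_of_ne (not_lt.1 this) (h2 i), (h1 i).symm⟩
    · intro q hq
      exact Prod.ext (by rw [(mem_pairsOf.1 hq).2, h1]) rfl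
    · intro i _; rfl
    · intro q _; rfl

lemma crossings_eq (P : Finset (Fin k × Fin k)) :
    crossings P = ∑ p ∈ P, ∑ q ∈ P, if p.1 < q.1 ∧ q.1 < p.2 ∧ p.2 < q.2 then 1 else 0 := by
  rw [crossings, Finset.card_filter, Finset.sum_product]

/-- The pairing that consists of `(0, t + 1)` and of the pairs of `μ` on the other indices. -/
def extendPairing (t : Fin (k + 1)) (μ : Fin k → Fin k) : Fin (k + 2) → Fin (k + 2) :=
  Fin.cons t.succ (t.insertNth (α := fun _ => Fin (k + 2)) 0 fun i => (t.succAbove (μ i)).succ)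

lemma forall_fin_pair {t : Fin (k + 1)} {P : Fin (k + 2) → Prop} :
    (∀ s, P s) ↔ P 0 ∧ P t.succ ∧ ∀ i, P (t.succAbove i).succ := by
  rw [Fin.forall_fin_succ, Fin.forall_iff_succAbove t]

@[simp] lemma extendPairing_zero (t : Fin (k + 1)) (μ : Fin k → Fin k) :
    extendPairing t μ 0 = t.succ := rfl

@[simp] lemma extendPairing_succ (t : Fin (k + 1)) (μ : Fin k → Fin k) :
    extendPairing t μ t.succ = 0 := by
  simp [extendPairing]

@[simp] lemma extendPairing_succAbove (t : Fin (k + 1)) (μ : Fin k → Fin k) (i : Fin k) :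
    extendPairing t μ (t.succAbove i).succ = (t.succAbove (μ i)).succ := by
  simp [extendPairing]

lemma pairsOf_extendPairing (t : Fin (k + 1)) (μ : Fin k → Fin k) :
    pairsOf (extendPairing t μ) = insert (0, t.succ)
      ((pairsOf μ).image fun q => ((t.succAbove q.1).succ, (t.succAbove q.2).succ)) := by
  have h : ∀ s q, (s, q) ∈ pairsOf (extendPairing t μ) ↔ (s, q) ∈ insert (0, t.succ)
      ((pairsOf μ).image fun q => ((t.succAbove q.1).succ, (t.succAbove q.2).succ)) := by
    intro s
    induction s using Fin.cases with
    | zero =>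
      intro q
      simp only [mem_pairsOf, extendPairing_zero, Finset.mem_insert, Finset.mem_image, Prod.mk.injEq]
      constructor
      · rintro ⟨-, rfl⟩; exact Or.inl ⟨trivial, rfl⟩
      · rintro (⟨-, rfl⟩ | ⟨q', -, h, -⟩)
        · exact ⟨Fin.succ_pos _, rfl⟩
        · exact absurd h (Fin.succ_ne_zero _)
    | succ s =>
      intro q
      by_cases hs : s = t
      · subst hs
        simp only [mem_pairsOf, extendPairing_succ, Finset.mem_insert, Finset.mem_image,
          Prod.mk.injEq]
        constructor
        · rintro ⟨h1, rfl⟩; exact absurd h1 (Fin.not_lt_zero _)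
        · rintro (⟨h1, -⟩ | ⟨q', -, h1, -⟩)
          · exact absurd h1 (Fin.succ_ne_zero _)
          · exact absurd (Fin.succ_injective _ h1) (Fin.succAbove_ne _ _)
      · obtain ⟨i, rfl⟩ := Fin.exists_succAbove_eq hs
        simp only [mem_pairsOf, extendPairing_succAbove, Finset.mem_insert, Finset.mem_image,
          Prod.mk.injEq]
        constructor
        · rintro ⟨h1, rfl⟩
          refine Or.inr ⟨(i, μ i), ⟨?_, rfl⟩, rfl, rfl⟩
          simpa using h1
        · rintro (⟨h1, -⟩ | ⟨⟨q1, q2⟩, ⟨h0, h1⟩, h2, rfl⟩)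
          · exact absurd h1 (Fin.succ_ne_zero _)
          · have := Fin.succAbove_right_injective (Fin.succ_injective _ h2)
            simp only at this h0 h1
            subst this h1
            exact ⟨by simpa using h0, rfl⟩
  ext ⟨s, q⟩
  exact h s q

lemma pairsOf_prod_extendPairing {M : Type*} [CommMonoid M] (t : Fin (k + 1)) (μ : Fin k → Fin k)
    (f : Fin (k + 2) × Fin (k + 2) → M) :
    ∏ q ∈ pairsOf (extendPairing t μ), f q
      = f (0, t.succ) * ∏ q ∈ pairsOf μ, f ((t.succAbove q.1).succ, (t.succAbove q.2).succ) := by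
  rw [pairsOf_extendPairing, Finset.prod_insert, Finset.prod_image]
  · rintro ⟨a, b⟩ _ ⟨c, d⟩ _ h
    simpa using h
  · simp only [Finset.mem_image, Prod.mk.injEq, not_exists, not_and]
    intro q _ h
    exact absurd h (Fin.succ_ne_zero _)

/-- The pairs that cross `(0, t + 1)` are those with exactly one index below `t`. There are `t` such
indices, and a pair with both of them below does not affect the parity. -/
lemma crossings_extendPairing {t : Fin (k + 1)} {μ : Fin k → Fin k} (h1 : ∀ s, μ (μ s) = s)
    (h2 : ∀ s, μ s ≠ s) : (-1 : ℤ) ^ crossings (pairsOf (extendPairing t μ))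
      = (-1) ^ (t : ℕ) * (-1) ^ crossings (pairsOf μ) := by
  have hsum : ∀ f : Fin (k + 2) × Fin (k + 2) → ℕ, ∑ q ∈ pairsOf (extendPairing t μ), f q
      = f (0, t.succ) + ∑ q ∈ pairsOf μ, f ((t.succAbove q.1).succ, (t.succAbove q.2).succ) :=
    fun f => pairsOf_prod_extendPairing (M := Multiplicative ℕ) t μ f
  have h3 : crossings (pairsOf (extendPairing t μ)) = (∑ q ∈ pairsOf μ,
      if t.succAbove q.1 < t ∧ t < t.succAbove q.2 then 1 else 0) + crossings (pairsOf μ) := by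
    simp only [crossings_eq, hsum]
    simp
  have h4 : ∀ i : Fin k, (if t < t.succAbove i then (1 : ℤ) else -1)
      = if t.succAbove i < t then -1 else 1 := by
    intro i
    rcases lt_or_gt_of_ne (Fin.succAbove_ne t i) with h | h
    · rw [if_neg h.not_gt, if_pos h]
    · rw [if_pos h, if_neg h.not_gt]
  rw [h3, pow_add, ← Finset.prod_pow_eq_pow_sum, ← prod_neg_one_succAbove,
    ← prod_pairsOf h1 h2]
  congr 1
  refine Finset.prod_congr rfl fun q hq => ?_
  have hq' : t.succAbove q.1 < t.succAbove q.2 := by simpa using (mem_pairsOf.1 hq).1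
  rw [h4 q.1]
  by_cases ha : t.succAbove q.1 < t <;> by_cases hb : t < t.succAbove q.2 <;> simp [ha, hb]
  exact absurd (lt_of_le_of_ne (not_lt.1 ha) (Fin.succAbove_ne t q.1).symm |>.trans hq') hb

/-- A primitive eighth root of unity. -/
noncomputable def zeta8 : ℂ := Complex.exp (Real.pi / 4 * Complex.I)

lemma zeta8_ne_zero : zeta8 ≠ 0 := Complex.exp_ne_zero _

lemma zeta8_sq : zeta8 ^ 2 = Complex.I := by
  rw [zeta8, ← Complex.exp_nat_mul]
  refine Eq.trans ?_ Complex.exp_pi_div_two_mul_I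
  congr 1; push_cast; ring

lemma zeta8_zpow_four_mul (n : Fin 3) : zeta8 ^ (4 * ((n.val : ℤ) - 1)) = (-1) ^ (n.val + 1) := by
  have h4 : zeta8 ^ (4 : ℤ) = -1 := by
    have : zeta8 ^ (4 : ℕ) = -1 := by
      rw [show 4 = 2 * 2 from rfl, pow_mul, zeta8_sq, Complex.I_sq]
    exact_mod_cast this
  rw [zpow_mul, h4]
  fin_cases n <;> norm_num

/-- The exponent of `zeta8` in the phase of a path of total turn `T`. -/
def pathExp (e : Fin k → OEdge) (T : Fin k → ℤ) (q : Fin k × Fin k) : ℤ :=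
  ((e q.2).2.val : ℤ) - (e q.1).2.val - T q.1

/-- The phase of a pairing by paths of total turns `T`, for the standard square roots of the
orientations. -/
noncomputable def matchPhase (e : Fin k → OEdge) (μ : Fin k → Fin k) (T : Fin k → ℤ) : ℂ :=
  (-1) ^ crossings (pairsOf μ) * ∏ q ∈ pairsOf μ, zeta8 ^ pathExp e T q

end Pairings

/-! ### The phase of a configuration is its real sign -/

section PathSystem

variable {Ω : Finset Face} {k : ℕ}

/-- The paths of a configuration link the marked edges according to `μ`, and their total turns are
given by `T`. -/
def PathSystem (r : Face → Bool) (e : Fin k → OEdge) (ω : Finset (Sym2 Face)) (μ : Fin k → Fin k)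
    (T : Fin k → ℤ) : Prop :=
  ∀ s, μ (μ s) = s ∧ μ s ≠ s ∧ ∃ n, Run (next (fun _ => r) e ω) (turn (fun _ => r) e ω)
    (IsStop e) (e s) (rev (e (μ s))) n (T s)

lemma not_isStop_mark {e : Fin k → OEdge} (he : Function.Injective fun j => edge (e j)) (s : Fin k) :
    ¬ IsStop e (e s) := by
  rintro ⟨j, hj⟩
  exact rev_ne_mark he s j hj

lemma occupied_rev_mark (e : Fin k → OEdge) (ω : Finset (Sym2 Face)) (s : Fin k) :
    Occupied e ω (rev (e s)) := Or.inr ⟨s, rfl⟩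

lemma occ_cons (a : OEdge) (e : Fin k → OEdge) (ω : Finset (Sym2 Face)) :
    occ (Fin.cons a e : Fin (k + 1) → OEdge) ω (head a)
      = fun c => decide (edge (inc (head a) (c + 2)) ∈ ω) ||
        decide (∃ j, e j = inc (head a) (c + 2)) || decide (c = a.2 + 2) := by
  funext c
  rw [occ_eq, Bool.or_assoc]
  congr 1
  rw [Bool.eq_iff_iff]
  simp only [decide_eq_true_eq, Bool.or_eq_true, Fin.exists_fin_succ, Fin.cons_zero, Fin.cons_succ]
  rw [or_comm]
  refine or_congr Iff.rfl ?_
  constructor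
  · intro h
    rw [congrArg Prod.snd h, inc_snd, dir_add_two_add_two]
  · rintro rfl
    rw [dir_add_two_add_two, inc_head]

/-- The configuration after the first step of the path from the first marked edge. -/
lemma shorten_configs {a : OEdge} {e : Fin k → OEdge} {ω : Finset (Sym2 Face)}
    (hω : ω ∈ configs Ω (Fin.cons a e : Fin (k + 1) → OEdge)) {b : OEdge} (hb : edge b ∈ ω)
    (hba : tail b = head a) :
    ω.erase (edge b) ∈ configs Ω (Fin.cons b e : Fin (k + 1) → OEdge) := by
  obtain ⟨-, h2, -, -⟩ := mem_configs.1 hω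
  rw [Fin.forall_fin_succ] at h2
  simp only [Fin.cons_zero, Fin.cons_succ] at h2
  rw [configs_cons h2.2 h2.1] at hω
  have h := erase_mem_configs_cons_rev (c := rev b) h2.2 (by rwa [edge_rev])
    (by rw [head_rev, hba]; exact (Finset.mem_filter.1 hω).1)
  rwa [edge_rev, rev_rev] at h

/-- The second half of `b` stays in the configuration, as the half-edge of the new mark; only the
half-edge of `a` and the first half of `b` disappear. -/
lemma shorten_occupied {a : OEdge} {e : Fin k → OEdge} {ω : Finset (Sym2 Face)}
    (he : Function.Injective fun j => edge ((Fin.cons a e : Fin (k + 1) → OEdge) j))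
    (hω : ω ∈ configs Ω (Fin.cons a e : Fin (k + 1) → OEdge)) {b : OEdge} (hb : edge b ∈ ω)
    (hba : tail b = head a) (x : OEdge) :
    Occupied (Fin.cons b e : Fin (k + 1) → OEdge) (ω.erase (edge b)) x
      ↔ Occupied (Fin.cons a e : Fin (k + 1) → OEdge) ω x ∧ x ≠ rev a ∧ x ≠ b := by
  have h3 := (mem_configs.1 hω).2.2.1
  rw [Fin.forall_fin_succ] at h3
  simp only [Fin.cons_zero, Fin.cons_succ] at h3
  have hea : ∀ j, edge (e j) ≠ edge a := fun j h => by
    have := @he j.succ 0 (by simpa using h)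
    exact absurd this (Fin.succ_ne_zero _)
  have heb : ∀ j, edge (e j) ≠ edge b := fun j h => h3.2 j (by rwa [h])
  have hab : edge a ≠ edge b := fun h => h3.1 (by rwa [h])
  simp only [occupied_iff, Fin.exists_fin_succ, Fin.cons_zero, Fin.cons_succ, Finset.mem_erase]
  have hbr : b = rev x ↔ x = rev b := by
    constructor <;> (intro h; rw [h, rev_rev])
  have har : a = rev x ↔ x = rev a := by
    constructor <;> (intro h; rw [h, rev_rev])
  rw [hbr, har]
  by_cases h1 : x = rev b
  · subst h1
    have h4 : rev b ≠ rev a := fun h => hab (by rw [rev_injective h])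
    simp [hb, h4, rev_ne]
  by_cases h2 : x = b
  · subst h2
    simp [h1, fun j => (show e j ≠ rev x from fun h => heb j (by rw [h, edge_rev]))]
  by_cases h4 : x = rev a
  · subst h4
    have : rev a ≠ rev b := h1
    simp [h1, h3.1, fun j => (show e j ≠ a from fun h => hea j (by rw [h]))]
  · have h5 : edge x ≠ edge b := fun h => by
      rcases edge_eq_iff.1 h with h | h
      · exact h2 h
      · exact h1 h
    simp [h1, h2, h4, h5]

lemma odd_arcSign {e : Fin k → OEdge} (he : Function.Injective fun j => edge (e j))
    (hΩ : ∀ j, head (e j) ∈ Ω) {v : Face} {X : Finset (Sym2 Face)} (hX : X ⊆ dualEdges Ω)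
    (hpar : ∀ p ≠ v, Even (degree X p + marks e p)) :
    ∃ B : ℤ, B * B = 1 ∧ ∀ d, arcSign e X (inc v d)
      = B * (-1) ^ locExp (fun c => (decide (edge (inc v c) ∈ X)).toNat)
        (fun c => (decide (∃ j, e j = inc v c)).toNat) d := by
  obtain ⟨B, h1, h2⟩ := exists_arcSign_eq hX (injective_of_edge he) hΩ hpar
  refine ⟨B, h1, fun d => ?_⟩
  rw [h2, funext (edgeInd_eq_toNat X v), funext (markInd_eq_toNat e v)]

lemma parity_toNat {e : Fin k → OEdge} (he : Function.Injective fun j => edge (e j))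
    {X : Finset (Sym2 Face)} (hX : X ⊆ dualEdges Ω) (v : Face) :
    degree X v + marks e v = ∑ c, (decide (edge (inc v c) ∈ X)).toNat
      + ∑ c, (decide (∃ j, e j = inc v c)).toNat := by
  rw [degree_eq hX, marks_eq (injective_of_edge he), funext (edgeInd_eq_toNat X v),
    funext (markInd_eq_toNat e v)]

lemma cons_edge_injective_iff {a : OEdge} {e : Fin k → OEdge} :
    (Function.Injective fun j => edge ((Fin.cons a e : Fin (k + 1) → OEdge) j))
      ↔ (∀ j, edge (e j) ≠ edge a) ∧ Function.Injective fun j => edge (e j) := by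
  have : (fun j => edge ((Fin.cons a e : Fin (k + 1) → OEdge) j))
      = (Fin.cons (edge a) fun j => edge (e j) : Fin (k + 1) → Sym2 Face) := by
    funext j
    induction j using Fin.cases <;> rfl
  rw [this, Fin.cons_injective_iff]
  simp

/-- After `b` is moved back through its edge, the old and the new mark sit at the same face `head
a`, so their factors share the constant `B` and `shorten_sign` compares them. -/
lemma shorten_weight {r : Face → Bool} {a : OEdge} {e : Fin k → OEdge} {ω : Finset (Sym2 Face)}
    (he : Function.Injective fun j => edge ((Fin.cons a e : Fin (k + 1) → OEdge) j))
    (hω : ω ∈ configs Ω (Fin.cons a e : Fin (k + 1) → OEdge)) {b : OEdge}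
    (hba : b = next (fun _ => r) (Fin.cons a e : Fin (k + 1) → OEdge) ω a) (hb : edge b ∈ ω) :
    (weight (Fin.cons a e : Fin (k + 1) → OEdge) ω : ℂ)
      = zeta8 ^ ((b.2.val : ℤ) - a.2.val
          - turn (fun _ => r) (Fin.cons a e : Fin (k + 1) → OEdge) ω a) *
        weight (Fin.cons b e : Fin (k + 1) → OEdge) (ω.erase (edge b)) := by
  obtain ⟨h1, h2, h3, -⟩ := mem_configs.1 hω
  rw [Fin.forall_fin_succ] at h2 h3
  simp only [Fin.cons_zero, Fin.cons_succ] at h2 h3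
  obtain ⟨hea, hei⟩ := cons_edge_injective_iff.1 he
  have heb : ∀ j, edge (e j) ≠ edge b := fun j h => h3.2 j (by rwa [h])
  rw [configs_cons h2.2 h2.1] at hω
  obtain ⟨-, -, h4⟩ := mem_oddConfigs.1 (Finset.mem_filter.1 hω).1
  have hpar : ∀ p ≠ head a, Even (degree ω p + marks e p) := by
    intro p hp
    by_cases hpΩ : p ∈ Ω
    · exact (h4 p hpΩ).2 hp
    · simp [degree_of_notMem h1 hpΩ, marks_of_notMem h2.2 hpΩ]
  have hodd : ¬ Even (degree ω (head a) + marks e (head a)) := fun h => (h4 _ h2.1).1 h rfl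
  rw [parity_toNat hei h1] at hodd
  obtain ⟨B, hB1, hB⟩ := odd_arcSign hei h2.2 h1 hpar
  rw [next_eq, occ_cons] at hba
  have hb2 : inc (head a) (b.2 + 2) = rev b := by
    have h : head (rev b) = head a := by rw [head_rev, hba]; rfl
    exact (eq_inc h).symm
  have hsign := shorten_sign (fun c => decide (edge (inc (head a) c) ∈ ω))
    (fun c => decide (∃ j, e j = inc (head a) c)) (r (head a)) a.2
    (edge_mark_disjoint h3.2 _) (by
      rw [inc_head]
      simp [h3.1, fun j => (show e j ≠ a from fun h => hea j (by rw [h]))]) hodd b.2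
    (congrArg Prod.snd hba) (by rw [hb2, edge_rev]; simpa using hb)
  obtain ⟨n, hn1, hn2⟩ := hsign
  rw [turn_eq, occ_cons, hn1, zeta8_zpow_four_mul]
  have hw := arcSign_erase_mul_weight hb heb
  rw [weight_cons (injective_of_edge hei) fun j h => hea j (by rw [h]),
    weight_cons (injective_of_edge hei) fun j h => heb j (by rw [h]), hw, ← hb2, hB]
  have hBa := hB a.2
  rw [inc_head] at hBa
  rw [hBa, hn2]
  push_cast
  ring

lemma remove_configs {a : OEdge} {e : Fin (k + 1) → OEdge} {ω : Finset (Sym2 Face)}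
    (hω : ω ∈ configs Ω (Fin.cons a e : Fin (k + 2) → OEdge)) {t : Fin (k + 1)}
    (ht : head (e t) = head a) : ω ∈ configs Ω (e ∘ t.succAbove) := by
  obtain ⟨h1, h2, h3, -⟩ := mem_configs.1 hω
  refine mem_configs.2 ⟨h1, fun j => h2 (t.succAbove j).succ, fun j => h3 (t.succAbove j).succ,
    fun p _ => ?_⟩
  have h := even_of_mem_configs hω p
  rw [marks_cons, marks_succAbove e t, ht] at h
  by_cases hp : head a = p
  · simp only [hp, if_true] at h
    rw [Nat.even_iff] at h ⊢
    omega
  · simpa [hp] using h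

lemma remove_occupied {a : OEdge} {e : Fin (k + 1) → OEdge} {ω : Finset (Sym2 Face)}
    (he : Function.Injective fun j => edge ((Fin.cons a e : Fin (k + 2) → OEdge) j))
    (hω : ω ∈ configs Ω (Fin.cons a e : Fin (k + 2) → OEdge)) (t : Fin (k + 1)) (x : OEdge) :
    Occupied (e ∘ t.succAbove) ω x
      ↔ Occupied (Fin.cons a e : Fin (k + 2) → OEdge) ω x ∧ x ≠ rev a ∧ x ≠ rev (e t) := by
  obtain ⟨hea, hei⟩ := cons_edge_injective_iff.1 he
  have h3 := (mem_configs.1 hω).2.2.1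
  rw [Fin.forall_fin_succ] at h3
  simp only [Fin.cons_zero, Fin.cons_succ] at h3
  have hr : ∀ c, c = rev x ↔ x = rev c := by
    intro c
    constructor <;> (intro h; rw [h, rev_rev])
  simp only [occupied_iff, Fin.exists_fin_succ, Fin.exists_iff_succAbove t, Fin.cons_zero,
    Fin.cons_succ, Function.comp_apply, hr]
  constructor
  · rintro (h | ⟨i, rfl⟩)
    · refine ⟨Or.inl h, ?_, ?_⟩ <;> rintro rfl
      · exact h3.1 (by rwa [edge_rev] at h)
      · exact h3.2 t (by rwa [edge_rev] at h)
    · refine ⟨Or.inr (Or.inr (Or.inr ⟨i, rfl⟩)), fun h => hea _ (congrArg edge (rev_injective h)),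
        fun h => Fin.succAbove_ne t i (hei (congrArg edge (rev_injective h)))⟩
  · rintro ⟨h | h | h | h, h4, h5⟩
    · exact Or.inl h
    · exact absurd h h4
    · exact absurd h h5
    · exact Or.inr h

/-- Bringing `a` and then `e t` to the front produces `(-1) ^ t`, their relative sign and one factor
for each of them. Both factors carry the constant `B` of the same face, which drops out. -/
lemma remove_weight {r : Face → Bool} {a : OEdge} {e : Fin (k + 1) → OEdge}
    {ω : Finset (Sym2 Face)}
    (he : Function.Injective fun j => edge ((Fin.cons a e : Fin (k + 2) → OEdge) j))
    (hω : ω ∈ configs Ω (Fin.cons a e : Fin (k + 2) → OEdge)) {t : Fin (k + 1)}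
    (ht : next (fun _ => r) (Fin.cons a e : Fin (k + 2) → OEdge) ω a = rev (e t)) :
    Complex.I * weight (Fin.cons a e : Fin (k + 2) → OEdge) ω
        = (-1) ^ (t : ℕ) * zeta8 ^ (((e t).2.val : ℤ) - a.2.val
          - turn (fun _ => r) (Fin.cons a e : Fin (k + 2) → OEdge) ω a) *
        weight (e ∘ t.succAbove) ω := by
  obtain ⟨h1, h2, h3, -⟩ := mem_configs.1 hω
  rw [Fin.forall_fin_succ] at h2 h3
  simp only [Fin.cons_zero, Fin.cons_succ] at h2 h3
  obtain ⟨hea, hei⟩ := cons_edge_injective_iff.1 he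
  have hinj := injective_of_edge hei
  set e' := e ∘ t.succAbove with he'
  have hei' : Function.Injective fun j => edge (e' j) :=
    hei.comp (Fin.succAbove_right_injective (p := t))
  have hΩ' : ∀ j, head (e' j) ∈ Ω := fun j => h2.2 _
  have h3' : ∀ j, edge (e' j) ∉ ω := fun j => h3.2 _
  have hhead : head (e t) = head a := by
    rw [← tail_rev, ← ht, next_eq]; rfl
  have het : e t = inc (head a) (e t).2 := eq_inc hhead
  have hmarks := even_of_mem_configs (remove_configs hω hhead)
  rw [← he'] at hmarks
  obtain ⟨B, hB1, hB⟩ := odd_arcSign hei' hΩ' h1 (v := head a) fun p _ => hmarks p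
  have heven' := hmarks (head a)
  rw [parity_toNat hei' h1] at heven'
  have hocc : occ (Fin.cons a e : Fin (k + 2) → OEdge) ω (head a)
      = fun c => decide (edge (inc (head a) (c + 2)) ∈ ω) ||
        decide (∃ j, e' j = inc (head a) (c + 2)) || decide (c = a.2 + 2) ||
        decide (c = (e t).2 + 2) := by
    rw [occ_cons]
    funext c
    have : decide (∃ j, e j = inc (head a) (c + 2))
        = (decide (∃ j, e' j = inc (head a) (c + 2)) || decide (c = (e t).2 + 2)) := by
      rw [Bool.eq_iff_iff]
      simp only [decide_eq_true_eq, Bool.or_eq_true, Fin.exists_iff_succAbove t]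
      rw [or_comm]
      refine or_congr Iff.rfl ?_
      constructor
      · intro h
        rw [congrArg Prod.snd h, inc_snd, dir_add_two_add_two]
      · rintro rfl
        rw [dir_add_two_add_two, ← het]
    rw [this]
    generalize decide (edge (inc (head a) (c + 2)) ∈ ω) = x
    generalize decide (∃ j, e' j = inc (head a) (c + 2)) = y
    generalize decide (c = a.2 + 2) = z
    generalize decide (c = (e t).2 + 2) = w
    revert x y z w; decide
  have hta : (e t).2 ≠ a.2 := fun h => hea t (by rw [het, h, inc_head])
  have hne' : ∀ j, e' j ≠ e t := fun j h => Fin.succAbove_ne t j (hinj h)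
  obtain ⟨n, hn1, hn2⟩ := remove_sign (fun c => decide (edge (inc (head a) c) ∈ ω))
    (fun c => decide (∃ j, e' j = inc (head a) c)) (r (head a)) a.2 (e t).2
    (edge_mark_disjoint h3' _) (by
      rw [← het, inc_head]
      simp [h3.1, h3.2, hta, hne', fun j => (show e' j ≠ a from fun h => hea _ (by rw [← h]; rfl))])
    heven' (by
      rw [next_eq, hocc] at ht
      exact congrArg Prod.snd ht)
  have hsgn : sgn a (e t) = dirSgn a.2 (e t).2 := by
    rw [← sgn_inc (head a), ← het, inc_head]
  rw [turn_eq, hocc, hn1, zpow_add₀ zeta8_ne_zero, zeta8_zpow_four_mul,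
    show zeta8 ^ (2 : ℤ) = Complex.I from mod_cast zeta8_sq,
    weight_cons hinj fun j h => hea j (by rw [h]), weight_succAbove hinj ω t, arcSign_succAbove t,
    if_neg fun h => hea t (by rw [h]), ← he', hsgn]
  have hBa := hB a.2
  have hBt := hB (e t).2
  rw [inc_head] at hBa
  rw [← het] at hBt
  have hn3 : dirSgn a.2 (e t).2 * arcSign e' ω a * arcSign e' ω (e t) = (-1) ^ (n.val + 1) := by
    rw [← hn2, hBa, hBt]
    linear_combination dirSgn a.2 (e t).2 * (-1) ^ locExp _ _ a.2 * (-1) ^ locExp _ _ (e t).2 * hB1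
  have hn4 := congrArg (Int.cast : ℤ → ℂ) hn3
  push_cast at hn4 ⊢
  linear_combination Complex.I * (-1) ^ (t : ℕ) * (weight e' ω : ℂ) * hn4

/-- Only the pair of `0` changes. The turn read backwards from `μ 0` is irrelevant, because
`pathExp` uses the smaller index of each pair. -/
lemma matchPhase_shorten {a b : OEdge} {e : Fin k → OEdge} {μ : Fin (k + 1) → Fin (k + 1)}
    {T T' : Fin (k + 1) → ℤ} {τ : ℤ} (h1 : ∀ s, μ (μ s) = s) (h2 : ∀ s, μ s ≠ s)
    (h0 : T 0 = τ + T' 0) (hT : ∀ s, s ≠ 0 → s ≠ μ 0 → T s = T' s) :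
    matchPhase (Fin.cons a e : Fin (k + 1) → OEdge) μ T
      = zeta8 ^ ((b.2.val : ℤ) - a.2.val - τ)
        * matchPhase (Fin.cons b e : Fin (k + 1) → OEdge) μ T' := by
  have hpos : 0 < μ 0 := Fin.pos_of_ne_zero (h2 0)
  have hmem : (0, μ 0) ∈ pairsOf μ := mem_pairsOf.2 ⟨hpos, rfl⟩
  have hother : ∀ q ∈ (pairsOf μ).erase (0, μ 0),
      zeta8 ^ pathExp (Fin.cons a e : Fin (k + 1) → OEdge) T q
        = zeta8 ^ pathExp (Fin.cons b e : Fin (k + 1) → OEdge) T' q := by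
    rintro ⟨s, d⟩ hq
    obtain ⟨hne, hq⟩ := Finset.mem_erase.1 hq
    obtain ⟨hlt, hd⟩ := mem_pairsOf.1 hq
    simp only at hlt hd
    have hs0 : s ≠ 0 := fun h => hne (by rw [hd, h])
    have hd0 : d ≠ 0 := (lt_of_le_of_lt (Fin.zero_le s) hlt).ne'
    have hsμ : s ≠ μ 0 := fun h => hd0 (by rw [hd, h, h1])
    obtain ⟨s', rfl⟩ := Fin.exists_succ_eq.2 hs0
    obtain ⟨d', rfl⟩ := Fin.exists_succ_eq.2 hd0
    simp [pathExp, hT _ hs0 hsμ]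
  obtain ⟨j, hj⟩ := Fin.exists_succ_eq.2 (h2 0)
  rw [matchPhase, matchPhase, ← Finset.mul_prod_erase _ _ hmem, ← Finset.mul_prod_erase _ _ hmem,
    Finset.prod_congr rfl hother]
  have hexp : pathExp (Fin.cons a e : Fin (k + 1) → OEdge) T (0, μ 0)
      = ((b.2.val : ℤ) - a.2.val - τ) + pathExp (Fin.cons b e : Fin (k + 1) → OEdge) T' (0, μ 0) := by
    simp only [pathExp, h0, ← hj, Fin.cons_zero, Fin.cons_succ]
    ring
  rw [hexp, zpow_add₀ zeta8_ne_zero]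
  ring

lemma matchPhase_extend {a : OEdge} {e : Fin (k + 1) → OEdge} {t : Fin (k + 1)}
    {μ : Fin k → Fin k} {T' : Fin k → ℤ} {T : Fin (k + 2) → ℤ} (h1 : ∀ s, μ (μ s) = s)
    (h2 : ∀ s, μ s ≠ s) (hT : ∀ i, T (t.succAbove i).succ = T' i) :
    matchPhase (Fin.cons a e : Fin (k + 2) → OEdge) (extendPairing t μ) T
      = (-1) ^ (t : ℕ) * zeta8 ^ (((e t).2.val : ℤ) - a.2.val - T 0)
        * matchPhase (e ∘ t.succAbove) μ T' := by
  have hc := congrArg (Int.cast : ℤ → ℂ) (crossings_extendPairing (t := t) h1 h2)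
  push_cast at hc
  rw [matchPhase, matchPhase, hc, pairsOf_prod_extendPairing]
  simp only [pathExp, Fin.cons_zero, Fin.cons_succ, hT, Function.comp_apply]
  ring

/-- Induction on the number of edges and marks, by one step of the path from the first mark. If the
next edge is full, the mark moves across it and the edge is erased; otherwise the path ends at
another mark and both are deleted. Loops are never traversed: once no mark is left, both sides are
`1` whatever walls remain. -/
theorem exists_pathSystem (r : Face → Bool) (N : ℕ) : ∀ {k : ℕ} (e : Fin k → OEdge)
    (ω : Finset (Sym2 Face)), ω.card + k ≤ N → (Function.Injective fun j => edge (e j)) →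
    ω ∈ configs Ω e → ∃ μ T, PathSystem r e ω μ T ∧
      matchPhase e μ T = Complex.I ^ (k / 2) * weight e ω := by
  induction N with
  | zero =>
    intro k e ω hN _ _
    obtain rfl : k = 0 := by omega
    exact ⟨id, 0, fun s => s.elim0, by
      simp [matchPhase, pairsOf, crossings, weight, Finset.univ_eq_empty]⟩
  | succ N ih =>
    intro k e ω hN he hω
    cases k with
    | zero =>
      exact ⟨id, 0, fun s => s.elim0, by
        simp [matchPhase, pairsOf, crossings, weight, Finset.univ_eq_empty]⟩
    | succ k =>
      obtain ⟨a, e, rfl⟩ : ∃ a e', e = (Fin.cons a e' : Fin (k + 1) → OEdge) :=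
        ⟨e 0, Fin.tail e, (Fin.cons_self_tail e).symm⟩
      have ha : Occupied (Fin.cons a e : Fin (k + 1) → OEdge) ω (rev a) :=
        occupied_rev_mark (Fin.cons a e : Fin (k + 1) → OEdge) ω 0
      obtain ⟨hb1, hb2, hb3, hb4, hb5⟩ := next_spec (r := r) he hω ha
      set b := next (fun _ => r) (Fin.cons a e : Fin (k + 1) → OEdge) ω a with hb
      obtain ⟨hea, hei⟩ := cons_edge_injective_iff.1 he
      have hedges := (mem_configs.1 hω).2.2.1
      have ha0 := not_isStop_mark he 0
      rw [Fin.cons_zero] at ha0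
      by_cases hbω : edge b ∈ ω
      · have hω' := shorten_configs hω hbω hb3
        have hO := shorten_occupied he hω hbω hb3
        have heb : ∀ j, edge (e j) ≠ edge b := fun j h => hedges j.succ (by
          rw [Fin.cons_succ, h]; exact hbω)
        have he' : Function.Injective fun j => edge ((Fin.cons b e : Fin (k + 1) → OEdge) j) :=
          cons_edge_injective_iff.2 ⟨heb, hei⟩
        obtain ⟨μ, T, hP, hM⟩ := ih (Fin.cons b e : Fin (k + 1) → OEdge) (ω.erase (edge b)) (by
          have := Finset.card_erase_add_one hbω; omega) he' hω'
        have hnb : ∀ c, edge c = edge b → ¬ IsStop (Fin.cons a e : Fin (k + 1) → OEdge) c := by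
          rintro c hc ⟨j, rfl⟩
          exact hedges j (by rw [edge_rev] at hc; rwa [hc])
        have hS : ∀ x, Occupied (Fin.cons b e : Fin (k + 1) → OEdge) (ω.erase (edge b)) x →
            ¬ IsStop (Fin.cons b e : Fin (k + 1) → OEdge) x →
            ¬ IsStop (Fin.cons a e : Fin (k + 1) → OEdge) x := by
          rintro x hx hxs ⟨j, rfl⟩
          induction j using Fin.cases with
          | zero => exact ((hO _).1 hx).2.1 rfl
          | succ j => exact hxs ⟨j.succ, rfl⟩
        have hlift : ∀ {s c n T}, Run _ _ _ ((Fin.cons b e : Fin (k + 1) → OEdge) s) c n T →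
            Run _ _ _ ((Fin.cons b e : Fin (k + 1) → OEdge) s) c n T := fun {s c n T} h =>
          run_lift he hω ha he' hω' hO hS h fun _ =>
            ⟨occupied_rev_mark _ _ s, by
              induction s using Fin.cases with
              | zero => exact hnb b rfl
              | succ s => exact not_isStop_mark he s.succ⟩
        set τ := turn (fun _ => r) (Fin.cons a e : Fin (k + 1) → OEdge) ω a with hτ
        have hμ1 : ∀ s, μ (μ s) = s := fun s => (hP s).1
        have hμ2 : ∀ s, μ s ≠ s := fun s => (hP s).2.1
        -- The path from `0` gains the turn `τ`; the same path read from its other end gains the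
        -- opposite turn.
        refine ⟨μ, fun s => if s = 0 then τ + T s else if s = μ 0 then T s - τ else T s,
          fun s => ⟨hμ1 s, hμ2 s, ?_⟩, ?_⟩
        · obtain ⟨n, hn⟩ := (hP s).2.2
          have hn' := hlift hn
          by_cases hs : s = 0
          · subst hs
            obtain ⟨j, hj⟩ := Fin.exists_succ_eq.2 (hμ2 0)
            rw [← hj, Fin.cons_zero, Fin.cons_succ] at hn'
            refine ⟨n + 1, ?_⟩
            simp only [if_true]
            rw [← hj, Fin.cons_zero, Fin.cons_succ]
            exact Run.cons ha0 hn'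
          · obtain ⟨i, rfl⟩ := Fin.exists_succ_eq.2 hs
            by_cases hsμ : i.succ = μ 0
            · refine ⟨n + 1, ?_⟩
              have hμi : μ i.succ = 0 := by rw [hsμ, hμ1]
              simp only [if_neg hs, if_pos hsμ]
              rw [hμi, Fin.cons_zero, ← hb5, sub_eq_add_neg, ← hb4]
              rw [hμi] at hn'
              exact Run.snoc hn' (hnb _ (edge_rev b))
            · have hμi : μ i.succ ≠ 0 := fun h => hsμ (by rw [← h, hμ1])
              obtain ⟨j, hj⟩ := Fin.exists_succ_eq.2 hμi
              refine ⟨n, ?_⟩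
              simp only [if_neg hs, if_neg hsμ]
              rw [← hj]
              rw [← hj] at hn'
              exact hn'
        · rw [matchPhase_shorten (b := b) (T' := T) (τ := τ) hμ1 hμ2 (by simp) (fun s h1 h2 => by
            simp [h1, h2]), hM, shorten_weight he hω hb hbω]
          ring
      · obtain ⟨j, hj⟩ : IsStop (Fin.cons a e : Fin (k + 1) → OEdge) b := hb1.resolve_left hbω
        induction j using Fin.cases with
        | zero => exact absurd hj hb2
        | succ t =>
          rw [Fin.cons_succ] at hj
          cases k with
          | zero => exact t.elim0
          | succ k =>
            have hhead : head (e t) = head a := by rw [← hb3, hj, tail_rev]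
            have hω' := remove_configs hω hhead
            have hO := remove_occupied he hω t
            rw [← hj] at hO
            have he' : Function.Injective fun j => edge ((e ∘ t.succAbove) j) :=
              hei.comp (Fin.succAbove_right_injective (p := t))
            obtain ⟨μ, T, hP, hM⟩ := ih (e ∘ t.succAbove) ω (by omega) he' hω'
            have hS : ∀ x, Occupied (e ∘ t.succAbove) ω x → ¬ IsStop (e ∘ t.succAbove) x →
                ¬ IsStop (Fin.cons a e : Fin (k + 2) → OEdge) x := by
              rintro x hx hxs ⟨j, rfl⟩
              have h := hx.resolve_right hxs
              rw [edge_rev] at h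
              exact hedges j h
            set τ := turn (fun _ => r) (Fin.cons a e : Fin (k + 2) → OEdge) ω a with hτ
            have hμ1 : ∀ s, μ (μ s) = s := fun s => (hP s).1
            have hμ2 : ∀ s, μ s ≠ s := fun s => (hP s).2.1
            refine ⟨extendPairing t μ, Fin.cons τ (t.insertNth (α := fun _ => ℤ) (-τ) T),
              (forall_fin_pair (t := t)).2 ⟨?_, ?_, fun i => ?_⟩, ?_⟩
            · refine ⟨by simp, by simp, 1, ?_⟩
              have h1 := Run.nil (N := next (fun _ => r) (Fin.cons a e : Fin (k + 2) → OEdge) ω)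
                (t := turn (fun _ => r) (Fin.cons a e : Fin (k + 2) → OEdge) ω)
                (S := IsStop (Fin.cons a e : Fin (k + 2) → OEdge)) b
              have h2 := Run.cons ha0 h1
              rw [add_zero, hj] at h2
              simpa using h2
            · refine ⟨by simp, by simp [eq_comm], 1, ?_⟩
              have h1 := Run.nil (N := next (fun _ => r) (Fin.cons a e : Fin (k + 2) → OEdge) ω)
                (t := turn (fun _ => r) (Fin.cons a e : Fin (k + 2) → OEdge) ω)
                (S := IsStop (Fin.cons a e : Fin (k + 2) → OEdge)) (rev a)
              have het : rev b = e t := by rw [hj, rev_rev]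
              rw [het] at hb4 hb5
              rw [← hb5] at h1
              have h2 := Run.cons (not_isStop_mark he t.succ) h1
              rw [Fin.cons_succ, add_zero, hb4, hb5] at h2
              simpa using h2
            · refine ⟨by simp [hμ1], by simp [hμ2], ?_⟩
              obtain ⟨n, hn⟩ := (hP i).2.2
              refine ⟨n, ?_⟩
              have h := run_lift he hω ha he' hω' hO hS hn fun _ =>
                ⟨occupied_rev_mark _ _ i, not_isStop_mark he (t.succAbove i).succ⟩
              simpa using h
            · have hw := remove_weight he hω (hb.symm.trans hj)
              rw [matchPhase_extend (T' := T) hμ1 hμ2 (by simp), hM, Fin.cons_zero,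
                show (k + 1 + 1) / 2 = k / 2 + 1 by omega, pow_succ]
              linear_combination -Complex.I ^ (k / 2) * hw

end PathSystem

/-! ### The observable in terms of real signs -/

section Phase

variable {Ω : Finset Face} {k : ℕ}

/-- With `r = ρ ω` the path system computes pairing and windings. The answer does not contain `ρ`,
which is the independence of the resolution. -/
lemma phase_eq {e : Fin k → OEdge} (he : Function.Injective fun j => edge (e j))
    {ω : Finset (Sym2 Face)} (hω : ω ∈ configs Ω e) (ρ : Resolution) {ε η : Fin k → ℂ}
    (hε : ∀ j, ε j = η j * zeta8 ^ (e j).2.val) (hη : ∀ j, η j * η j = 1) :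
    phase ρ e ε ω = (∏ j, η j) * (Complex.I ^ (k / 2) * weight e ω) := by
  obtain ⟨μ, T, hP, hM⟩ := exists_pathSystem (ρ ω) (ω.card + k) e ω le_rfl he hω
  have hlen : ∀ s, EndsAt e (pathEdge ρ e ω s (pathLength ρ e ω s)) (μ s) ∧
      ∑ n ∈ Finset.range (pathLength ρ e ω s), turn ρ e ω (pathEdge ρ e ω s n) = T s := by
    intro s
    obtain ⟨n, hn⟩ := (hP s).2.2
    obtain ⟨h1, h2, h3⟩ := hn.iterate
    have hmem : n ∈ {n | ∃ j, EndsAt e (pathEdge ρ e ω s n) j} := ⟨μ s, h1⟩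
    -- The run meets no stop before its last step, so the infimum in `pathLength` is attained there.
    have : pathLength ρ e ω s = n := by
      refine le_antisymm (Nat.sInf_le hmem) ?_
      by_contra h
      exact h2 _ (not_le.1 h) (Nat.sInf_mem ⟨n, hmem⟩)
    rw [this]
    exact ⟨h1, h3⟩
  have hjoin : ∀ s d, Joined ρ e ω s d ↔ d = μ s := by
    intro s d
    have h1 := (hlen s).1
    constructor
    · intro h
      exact injective_of_edge he (rev_injective (h.symm.trans h1))
    · rintro rfl; exact h1
  have hpair : pairing ρ e ω = pairsOf μ := by
    ext q
    simp [pairing, pairsOf, hjoin]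
  have hfac : ∀ q ∈ pairsOf μ, ε q.2 / ε q.1 * Complex.exp (-(Complex.I / 2) *
      (winding ρ e ω q.1 : ℂ)) = (η q.1 * η q.2) * zeta8 ^ pathExp e T q := by
    intro q _
    have hexp : Complex.exp (-(Complex.I / 2) * (winding ρ e ω q.1 : ℂ)) = zeta8 ^ (-T q.1) := by
      rw [winding, (hlen q.1).2, zeta8, ← Complex.exp_int_mul]
      congr 1; push_cast; ring
    have hη0 : η q.1 ≠ 0 := left_ne_zero_of_mul_eq_one (hη q.1)
    have hz := zeta8_ne_zero
    rw [hexp, hε, hε, pathExp, sub_eq_add_neg _ (T q.1), zpow_add₀ hz, zpow_sub₀ hz, zpow_natCast,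
      zpow_natCast]
    -- As `η` takes the values `±1`, the quotient over a pair is a product, and over all pairs it
    -- becomes the product of all `η j`.
    have hinv : (η q.1)⁻¹ = η q.1 := inv_eq_of_mul_eq_one_left (hη q.1)
    rw [mul_div_mul_comm, div_eq_mul_inv (η q.2), hinv]
    ring
  rw [phase, hpair, Finset.prod_congr rfl hfac, Finset.prod_mul_distrib,
    prod_pairsOf (fun s => (hP s).1) (fun s => (hP s).2.1), ← hM, matchPhase]
  ring

/-- The value of `obsPoly` at `α`. -/
noncomputable def obsVal (Ω : Finset Face) (β : ℝ) (e : Fin k → OEdge) : ℂ :=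
  aeval (alpha β : ℂ) (obsPoly Ω e)

lemma obsVal_eq (β : ℝ) (e : Fin k → OEdge) :
    obsVal Ω β e = ∑ ω ∈ configs Ω e, (weight e ω : ℂ) * (alpha β : ℂ) ^ ω.card := by
  simp [obsVal, obsPoly]

lemma obsVal_elim0 (β : ℝ) (e : Fin 0 → OEdge) : obsVal Ω β e = partitionFn Ω β := by
  have : configs Ω e = contours Ω := by
    ext ω
    have hm : ∀ p, marks e p = 0 := fun p =>
      Finset.card_eq_zero.2 (Finset.filter_eq_empty_iff.2 fun j => j.elim0)
    rw [mem_configs, contours, Finset.mem_filter, Finset.mem_powerset]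
    simp [hm]
  rw [obsVal_eq, this, partitionFn]
  push_cast
  exact Finset.sum_congr rfl fun ω _ => by simp [weight]

lemma partitionFn_pos (Ω : Finset Face) (β : ℝ) : 0 < partitionFn Ω β := by
  refine Finset.sum_pos (fun ω _ => pow_pos (Real.exp_pos _) _) ⟨∅, ?_⟩
  exact Finset.mem_filter.2 ⟨Finset.empty_mem_powerset _, fun p _ => by
    rw [degree, Finset.filter_empty]; exact Even.zero⟩

lemma observable_eq (β : ℝ) {m : ℕ} {e : Fin (2 * m) → OEdge}
    (he : Function.Injective fun j => edge (e j)) (ρ : Resolution) {ε η : Fin (2 * m) → ℂ}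
    (hε : ∀ j, ε j = η j * zeta8 ^ (e j).2.val) (hη : ∀ j, η j * η j = 1) :
    observable Ω β ρ e ε = 1 / (partitionFn Ω β : ℂ) *
      ((∏ j, η j) * (Complex.I * alpha β) ^ m * obsVal Ω β e) := by
  rw [observable, obsVal_eq]
  congr 1
  rw [Finset.mul_sum]
  refine Finset.sum_congr rfl fun ω hω => ?_
  rw [phase_eq he hω ρ hε hη, show 2 * m / 2 = m by omega, pow_add, mul_pow]
  ring

/-- The configurations and the spins ignore the numbering of the marks; only the sorting sign sees
it. -/
lemma obsVal_cons_succAbove (β : ℝ) {e : Fin (k + 1) → OEdge}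
    (he : Function.Injective fun j => edge (e j)) (p : Fin (k + 1)) :
    obsVal Ω β (Fin.cons (e p) (e ∘ p.succAbove) : Fin (k + 1) → OEdge)
      = (-1) ^ (p : ℕ) * obsVal Ω β e := by
  have hinj := injective_of_edge he
  have hc : configs Ω (Fin.cons (e p) (e ∘ p.succAbove) : Fin (k + 1) → OEdge) = configs Ω e := by
    ext ω
    simp only [mem_configs, marks_cons, marks_succAbove e p,
      Fin.forall_iff_succAbove p (P := fun j => head (e j) ∈ Ω),
      Fin.forall_iff_succAbove p (P := fun j => edge (e j) ∉ ω), Fin.forall_fin_succ, Fin.cons_zero,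
      Fin.cons_succ, Function.comp_apply]
  rw [obsVal_eq, obsVal_eq, hc, Finset.mul_sum]
  refine Finset.sum_congr rfl fun ω _ => ?_
  rw [weight_cons (hinj.comp Fin.succAbove_right_injective)
    (fun j h => Fin.succAbove_ne p j (hinj h)), weight_succAbove hinj ω p]
  have h1 : ((-1 : ℂ) ^ (p : ℕ)) * (-1) ^ (p : ℕ) = 1 := by
    rw [← mul_pow]; simp
  push_cast
  linear_combination -(arcSign (e ∘ p.succAbove) ω (e p) : ℂ) * (weight (e ∘ p.succAbove) ω : ℂ) *
    (alpha β : ℂ) ^ ω.card * h1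

lemma obsVal_expansion (β : ℝ) {e : Fin (k + 1) → OEdge} {a : OEdge}
    (he : Function.Injective fun j => edge (e j)) (ha : ∀ j, edge (e j) ≠ edge a) :
    ∑ j : Fin (k + 1), (-1) ^ (j : ℕ) * obsVal Ω β ![a, e j] * obsVal Ω β (e ∘ j.succAbove)
      = partitionFn Ω β * obsVal Ω β (Fin.cons a e : Fin (k + 2) → OEdge) := by
  have h := congrArg (aeval (alpha β : ℂ)) (obsPoly_expansion (Ω := Ω) he ha)
  simp only [map_mul, map_sum, map_pow, map_neg, map_one] at h
  rw [← obsVal_elim0 β (Fin.elim0 : Fin 0 → OEdge), obsVal, obsVal, h]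
  refine Finset.sum_congr rfl fun j _ => ?_
  have : (![a, e j] : Fin 2 → OEdge) = (Fin.cons a (fun _ => e j) : Fin 2 → OEdge) := by
    funext i
    fin_cases i <;> rfl
  rw [this]; rfl

end Phase

/-! ### Pfaffians -/

section Pfaffian

/-- The permutation that maps `0` to `p` and acts as `τ` on the remaining indices. -/
def insertPerm {n : ℕ} (p : Fin (n + 1)) (τ : Equiv.Perm (Fin n)) : Equiv.Perm (Fin (n + 1)) :=
  p.cycleRange.symm * Equiv.Perm.decomposeFin.symm (0, τ)

variable {n : ℕ}

@[simp] lemma insertPerm_zero (p : Fin (n + 1)) (τ : Equiv.Perm (Fin n)) :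
    insertPerm p τ 0 = p := by
  simp [insertPerm]

@[simp] lemma insertPerm_succ (p : Fin (n + 1)) (τ : Equiv.Perm (Fin n)) (i : Fin n) :
    insertPerm p τ i.succ = p.succAbove (τ i) := by
  simp [insertPerm]

lemma sign_insertPerm (p : Fin (n + 1)) (τ : Equiv.Perm (Fin n)) :
    Equiv.Perm.sign (insertPerm p τ) = (-1) ^ (p : ℕ) * Equiv.Perm.sign τ := by
  simp [insertPerm, Equiv.Perm.sign_mul]

lemma insertPerm_bijective : Function.Bijective
    fun x : Fin (n + 1) × Equiv.Perm (Fin n) => insertPerm x.1 x.2 := by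
  rw [Fintype.bijective_iff_injective_and_card]
  constructor
  · rintro ⟨p, τ⟩ ⟨q, τ'⟩ h
    have h0 := congrArg (fun σ : Equiv.Perm (Fin (n + 1)) => σ 0) h
    simp only [insertPerm_zero] at h0
    subst h0
    refine Prod.ext rfl (Equiv.ext fun i => ?_)
    have hi := congrArg (fun σ : Equiv.Perm (Fin (n + 1)) => σ i.succ) h
    simpa using hi
  · simp [Fintype.card_perm, Nat.factorial_succ]

lemma sum_perm_succ {M : Type*} [AddCommMonoid M] (F : Equiv.Perm (Fin (n + 1)) → M) :
    ∑ σ, F σ = ∑ p, ∑ τ, F (insertPerm p τ) := by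
  rw [← Fintype.sum_prod_type' fun p τ => F (insertPerm p τ)]
  exact (Fintype.sum_bijective _ insertPerm_bijective _ _ fun _ => rfl).symm

/-- Permutations are grouped by the images `p` and `p.succAbove j` of the first two indices. No
antisymmetry of `A` is needed, since all rows `p` are kept; the prefactor is the quotient of the two
normalisations. -/
lemma pfaffian_succ {m : ℕ} (A : Matrix (Fin (2 * (m + 1))) (Fin (2 * (m + 1))) ℂ) :
    pfaffian A = 1 / (2 * ((m : ℂ) + 1)) * ∑ p : Fin (2 * m + 2), ∑ j : Fin (2 * m + 1),
      (-1) ^ (p : ℕ) * (-1) ^ (j : ℕ) * A p (p.succAbove j) *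
        pfaffian (A.submatrix (p.succAbove ∘ j.succAbove) (p.succAbove ∘ j.succAbove)) := by
  have hsum : ∑ σ : Equiv.Perm (Fin (2 * (m + 1))), ((Equiv.Perm.sign σ : ℤ) : ℂ) *
      ∏ s : Fin (m + 1), A (σ ⟨2 * s, by omega⟩) (σ ⟨2 * s + 1, by omega⟩)
      = ∑ p : Fin (2 * m + 2), ∑ j : Fin (2 * m + 1), ∑ τ : Equiv.Perm (Fin (2 * m)),
        (-1) ^ (p : ℕ) * (-1) ^ (j : ℕ) * A p (p.succAbove j) *
          (((Equiv.Perm.sign τ : ℤ) : ℂ) * ∏ s : Fin m,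
          (A.submatrix (p.succAbove ∘ j.succAbove) (p.succAbove ∘ j.succAbove))
            (τ ⟨2 * s, by omega⟩) (τ ⟨2 * s + 1, by omega⟩)) := by
    refine (sum_perm_succ (n := 2 * m + 1) _).trans (Finset.sum_congr rfl fun p _ => ?_)
    refine (sum_perm_succ (n := 2 * m) _).trans (Finset.sum_congr rfl fun j _ => ?_)
    refine Finset.sum_congr rfl fun τ _ => ?_
    have h0 : insertPerm p (insertPerm j τ) 0 = p := insertPerm_zero _ _
    have h1 : insertPerm p (insertPerm j τ) 1 = p.succAbove j := by
      rw [← Fin.succ_zero_eq_one, insertPerm_succ, insertPerm_zero]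
    have h2 : ∀ (i : ℕ) (hi : i < 2 * m), insertPerm p (insertPerm j τ) ⟨i + 2, by omega⟩
        = p.succAbove (j.succAbove (τ ⟨i, hi⟩)) := by
      intro i hi
      rw [← insertPerm_succ j τ, ← insertPerm_succ p]
      rfl
    have hprod : ∏ s : Fin (m + 1), A (insertPerm p (insertPerm j τ) ⟨2 * s, by omega⟩)
        (insertPerm p (insertPerm j τ) ⟨2 * s + 1, by omega⟩)
        = A p (p.succAbove j) * ∏ s : Fin m,
          (A.submatrix (p.succAbove ∘ j.succAbove) (p.succAbove ∘ j.succAbove))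
            (τ ⟨2 * s, by omega⟩) (τ ⟨2 * s + 1, by omega⟩) := by
      rw [Fin.prod_univ_succ]
      congr 1
      · exact congrArg₂ A h0 h1
      · refine Finset.prod_congr rfl fun s _ => ?_
        exact congrArg₂ A (h2 (2 * s) (by omega)) (h2 (2 * s + 1) (by omega))
    refine (congrArg _ hprod).trans ?_
    rw [sign_insertPerm, sign_insertPerm]
    push_cast
    ring
  rw [pfaffian, hsum]
  simp only [pfaffian, Finset.mul_sum]
  refine Finset.sum_congr rfl fun p _ => Finset.sum_congr rfl fun j _ =>
    Finset.sum_congr rfl fun τ _ => ?_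
  have hm : ((m : ℂ) + 1) ≠ 0 := by exact_mod_cast Nat.succ_ne_zero m
  have hf : ((m.factorial : ℕ) : ℂ) ≠ 0 := by exact_mod_cast m.factorial_ne_zero
  rw [Nat.factorial_succ, pow_succ]
  push_cast
  field_simp

/-- Every row `p` of `pfaffian_succ` gives the same value: moving `e p` to the front costs `(-1) ^
p`, which cancels the sign of the row. The `2m + 2` equal rows cancel the prefactor. Diagonal
entries never occur. -/
lemma pfaffian_obsVal (Ω : Finset Face) (β : ℝ) (c : ℂ) (m : ℕ) : ∀ (e : Fin (2 * m) → OEdge)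
    (_ : Function.Injective fun j => edge (e j)) (η : Fin (2 * m) → ℂ)
    (A : Matrix (Fin (2 * m)) (Fin (2 * m)) ℂ)
    (_ : ∀ j k, j ≠ k → A j k
      = 1 / (partitionFn Ω β : ℂ) * (η j * η k * c * obsVal Ω β ![e j, e k])),
    1 / (partitionFn Ω β : ℂ) * ((∏ j, η j) * c ^ m * obsVal Ω β e) = pfaffian A := by
  have hZ : (partitionFn Ω β : ℂ) ≠ 0 := by exact_mod_cast (partitionFn_pos Ω β).ne'
  induction m with
  | zero =>
    intro e _ η A _
    have h := obsVal_elim0 (Ω := Ω) β e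
    rw [h]
    have h2 : pfaffian A = 1 := by
      rw [pfaffian]
      rw [Finset.sum_eq_single 1 (fun σ _ hσ => absurd (Equiv.ext fun i => i.elim0) hσ) (by simp)]
      simp
    rw [h2]
    have h3 : ∏ j, η j = 1 := Finset.prod_eq_one fun i _ => i.elim0
    rw [h3]
    field_simp
  | succ m ih =>
    intro e he η A hA
    have hterm : ∀ p : Fin (2 * m + 2), ∑ j : Fin (2 * m + 1),
        (-1) ^ (p : ℕ) * (-1) ^ (j : ℕ) * A p (p.succAbove j) *
          pfaffian (A.submatrix (p.succAbove ∘ j.succAbove) (p.succAbove ∘ j.succAbove))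
        = 1 / (partitionFn Ω β : ℂ) * ((∏ j, η j) * c ^ (m + 1) * obsVal Ω β e) := by
      intro p
      have hep : Function.Injective fun j => edge ((e ∘ p.succAbove) j) :=
        he.comp (Fin.succAbove_right_injective (p := p))
      have hexp := obsVal_expansion (Ω := Ω) β hep (a := e p)
        fun j h => Fin.succAbove_ne p j (he h)
      rw [obsVal_cons_succAbove β he p] at hexp
      have hj : ∀ j : Fin (2 * m + 1), (-1) ^ (p : ℕ) * (-1) ^ (j : ℕ) * A p (p.succAbove j) *
          pfaffian (A.submatrix (p.succAbove ∘ j.succAbove) (p.succAbove ∘ j.succAbove))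
          = (-1) ^ (p : ℕ) * (1 / (partitionFn Ω β : ℂ)) ^ 2 * (∏ j, η j) * c ^ (m + 1) *
            ((-1) ^ (j : ℕ) * obsVal Ω β ![e p, (e ∘ p.succAbove) j] *
              obsVal Ω β ((e ∘ p.succAbove) ∘ j.succAbove)) := by
        intro j
        have hinj : Function.Injective (p.succAbove ∘ j.succAbove) :=
          Fin.succAbove_right_injective.comp Fin.succAbove_right_injective
        rw [hA p (p.succAbove j) (Fin.succAbove_ne p j).symm,
          ← ih (e ∘ (p.succAbove ∘ j.succAbove)) (he.comp hinj) (η ∘ (p.succAbove ∘ j.succAbove))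
            (A.submatrix (p.succAbove ∘ j.succAbove) (p.succAbove ∘ j.succAbove))
            fun i l hil => hA _ _ fun h => hil (hinj h)]
        have hη : ∏ j, η j = η p * (η (p.succAbove j) *
            ∏ i, (η ∘ (p.succAbove ∘ j.succAbove)) i) := by
          refine (Fin.prod_univ_succAbove η p).trans ?_
          exact congrArg _ (Fin.prod_univ_succAbove (fun i => η (p.succAbove i)) j)
        rw [hη, pow_succ, Function.comp_assoc]
        simp only [Function.comp_apply]
        ring
      rw [Finset.sum_congr rfl fun j _ => hj j, ← Finset.mul_sum, hexp]
      have h1 : ((-1 : ℂ) ^ (p : ℕ)) * (-1) ^ (p : ℕ) = 1 := by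
        rw [← mul_pow]; simp
      field_simp
      linear_combination ((∏ j, η j) * c ^ (m + 1) * obsVal Ω β e) * h1
    rw [pfaffian_succ, Finset.sum_congr rfl fun p _ => hterm p, Finset.sum_const, Finset.card_univ,
      Fintype.card_fin, nsmul_eq_mul]
    have hm : ((m : ℂ) + 1) ≠ 0 := by exact_mod_cast Nat.succ_ne_zero m
    push_cast
    field_simp

end Pfaffian

/-! ### The Pfaffian formula -/

lemma zeta8_pow_mul_self (d : Dir) : zeta8 ^ d.val * zeta8 ^ d.val = dirC d := by
  rw [← mul_pow, ← sq, zeta8_sq, dirC]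

end Parafermion

theorem mainTheorem8
    (Ω : Finset Parafermion.Face) (β : ℝ) (n : ℕ)
    (e : Fin (2 * n) → Parafermion.OEdge)
    (he : ∀ j, Parafermion.IsEdgeOf Ω (e j))
    (hdistinct : Function.Injective fun j => Parafermion.edge (e j))
    (ε : Fin (2 * n) → ℂ)
    (hε : ∀ j, ε j ^ 2 = Parafermion.dirC (e j).2)
    (ρ : Parafermion.Resolution)
    (ρ₂ : Fin (2 * n) → Fin (2 * n) → Parafermion.Resolution) :
    (Parafermion.twoPointMatrix Ω β ρ₂ e ε).transpose
        = -Parafermion.twoPointMatrix Ω β ρ₂ e ε ∧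
      Parafermion.observable Ω β ρ e ε
        = Parafermion.pfaffian (Parafermion.twoPointMatrix Ω β ρ₂ e ε) := by
  open Parafermion in
  -- Both `ε j` and the power of `zeta8` are square roots of the orientation, so their quotient is
  -- `±1`.
  set η : Fin (2 * n) → ℂ := fun j => ε j / zeta8 ^ (e j).2.val with hηdef
  have hz : ∀ d : Dir, zeta8 ^ d.val ≠ 0 := fun d => pow_ne_zero _ zeta8_ne_zero
  have hεη : ∀ j, ε j = η j * zeta8 ^ (e j).2.val := fun j => (div_mul_cancel₀ _ (hz _)).symm
  have hη : ∀ j, η j * η j = 1 := by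
    intro j
    have h1 := zeta8_pow_mul_self (e j).2
    rw [← hε j] at h1
    have h2 : ε j ≠ 0 := fun h => mul_ne_zero (hz (e j).2) (hz (e j).2) (by rw [h1, h]; simp)
    simp only [hηdef]
    rw [div_mul_div_comm, h1, ← sq, div_self (pow_ne_zero 2 h2)]
  have hA : ∀ j k, j ≠ k → twoPointMatrix Ω β ρ₂ e ε j k = 1 / (partitionFn Ω β : ℂ) *
      (η j * η k * (Complex.I * alpha β) * obsVal Ω β ![e j, e k]) := by
    intro j k hjk
    have hinj : Function.Injective fun i => edge ((![e j, e k] : Fin (2 * 1) → OEdge) i) := by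
      intro i l hil
      fin_cases i <;> fin_cases l
      · rfl
      · exact absurd (hdistinct hil) hjk
      · exact absurd (hdistinct hil) hjk.symm
      · rfl
    have h := observable_eq (Ω := Ω) β (m := 1) hinj (ρ₂ j k) (ε := ![ε j, ε k]) (η := ![η j, η k])
      (fun i => by fin_cases i; exacts [hεη j, hεη k])
      (fun i => by fin_cases i; exacts [hη j, hη k])
    rw [twoPointMatrix, Matrix.of_apply, if_pos hjk, observable₂, h, pow_one,
      show ∏ i, (![η j, η k] : Fin (2 * 1) → ℂ) i = η j * η k from Fin.prod_univ_two _]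
  refine ⟨?_, ?_⟩
  · ext j k
    rw [Matrix.transpose_apply, Matrix.neg_apply]
    by_cases hjk : j = k
    · subst hjk
      simp [twoPointMatrix]
    · have hinj : Function.Injective fun i => edge ((![e j, e k] : Fin 2 → OEdge) i) := by
        intro i l hil
        fin_cases i <;> fin_cases l
        · rfl
        · exact absurd (hdistinct hil) hjk
        · exact absurd (hdistinct hil) (Ne.symm hjk)
        · rfl
      -- For two marks, bringing the second to the front exchanges them and gives the sign `-1`.
      have h := obsVal_cons_succAbove (Ω := Ω) β hinj 1
      have hcons : (Fin.cons ((![e j, e k] : Fin 2 → OEdge) 1) ((![e j, e k] : Fin 2 → OEdge) ∘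
          (1 : Fin 2).succAbove) : Fin 2 → OEdge) = ![e k, e j] := by
        funext i
        fin_cases i <;> rfl
      rw [hcons] at h
      rw [hA j k hjk, hA k j (Ne.symm hjk), h]
      simp only [Fin.val_one, pow_one]
      ring
  · rw [observable_eq β hdistinct ρ hεη hη]
    exact pfaffian_obsVal Ω β _ n e hdistinct η _ hA
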